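/- **Setting.** A temporal graph has a finite node set $V$, $n=|V|$, time stamps $1,\dots,r$, and for each time stamp $t$ a set $E_t$ of undirected edges without self-loops. Let $m=\sum_t|E_t|$ be the number of temporal edges. The input is, for each $t$, a list of the edges in $E_t$ in any order. For $T=[a,i]$ let $G[T]$ be the graph with edge set $\bigcup_{t\in T}E_t$, whose vertices are the endpoints of these edges; the density of a subgraph is $|E|/|V|$. Assume $m\ge 1$ and $r\le m$ (for example, every time stamp has at least one edge). **ApprDens** (incremental densest subgraph, edge insertions only, factor $2(1+\varepsilon_2)$). Let $\varepsilon=\min(\varepsilon_2,1)/3$ and $L=\lceil\log_{1+\varepsilon}n\rceil$; $L$ is computed once for all instances. An instance keeps the current graph $H$, a number $\beta$ (initially $\frac1{4(1+\varepsilon)}$), the best subgraph found and the density it had when found (initially $0$), a level in $\{0,\dots,L-1\}$ for each vertex, the sets $S_t$ of vertices of level at least $t$, and for each vertex $v$ and each $t$ the number $\deg_t(v)$ of neighbours of $v$ in $S_t$. An edge that is already present is ignored. A new edge $\{u,v\}$ is added (new vertices start at level $0$), and $u,v$ are put on a stack. While the stack is nonempty, a vertex $s$, of level $t$ say, is popped.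 If $\deg_t(s)<2(1+\varepsilon)\beta$ nothing happens. Otherwise let $t'>t$ be least with $\deg_{t'}(s)<2(1+\varepsilon)\beta$: if there is no such $t'<L$, the structure is rebuilt; else $s$ is lifted to level $t'$, the counters of its neighbours are updated, and its neighbours are pushed. A rebuild repeats the following: starting from all vertices of $H$, remove in rounds $0,\dots,L$ all vertices of degree less than $2(1+\varepsilon)\beta$ in the remaining graph, and take the densest of the successive induced subgraphs. If its density $\rho$ is at least $\beta$, it becomes the new best subgraph, $\beta$ is set to $(1+\varepsilon)\rho$, and the procedure is repeated; otherwise the rounds of removal define the new levels, the counters are recomputed, and the rebuild ends. The value returned by an instance is the recorded density of its best subgraph. **ApproxDP** with parameters $k\ge1$ and $\varepsilon_1$. Put $s[0,\ell]=0$ for all $\ell$. One instance of ApprDens receives $E_1,E_2,\dots,E_r$ in order, and $s[i,1]$ is its value after $E_i$. For $\ell=2,\dots,k$ start with an empty candidate list $A$, and for $i=1,\dots,r$: append $i$ to $A$ with a new empty instance of ApprDens; insert the edges of $E_i$ into the instances of all $a\in A$, so that the instance of $a$ holds $G[a,i]$, and let $d_a$ be its value; set $$s[i,\ell]=\max\{\,s[i-1,\ell],\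 s[i,\ell-1],\ \max_{a\in A}(s[a-1,\ell-1]+d_a)\,\};$$ then sparsify $A=(a_1<a_2<\dots)$ with $\delta=s[i,\ell]\frac{\varepsilon_1}{k+\ell\varepsilon_1}$: starting with $j=1$, while $j<|A|-1$, remove $a_{j+1}$ together with its instance if $f(a_{j+2})-f(a_j)\le\delta$, and increase $j$ by $1$ otherwise. Here $f(a)=s[a,\ell-1]$ or $f(a)=s[a-1,\ell-1]$; the statement holds for either choice. The output is the table $s$. **Cost model.** Unit-cost real RAM: an arithmetic operation or comparison, a branch, an access to one array cell, and a push or pop at an end of a list cost $O(1)$; an array with a default value in all cells is allocated in $O(1)$ time by lazy initialisation. **Proposition.** For every $M$ there is a constant $C$ such that for all temporal graphs as above, all $k\ge1$ and all $\varepsilon_1,\varepsilon_2\in(0,M]$, ApproxDP combined with ApprDens terminates after at most $$C\cdot\frac{k^2}{\varepsilon_1\varepsilon_2^2}\,m\log^2 n$$ steps. That is, it runs in time $O\!\left(\frac{k^2}{\varepsilon_1\varepsilon_2^2}\,m\log^2n\right)$ for bounded $\varepsilon_1,\varepsilon_2$. -/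

import Mathlib

/-! ### Step-counted computations

`Timed α` is a (possibly non-terminating) computation that returns a value of type `α` together with
the number of elementary steps it has executed.  The only source of cost is `step`; one `step` stands
for a bounded number of unit-cost real-RAM operations: an arithmetic operation or comparison on
numbers, a branch, reading or writing one array cell, pushing or popping at an end of a list.
Arrays are modelled by functions; a fresh array has a default value in all cells and is allocated in
constant time (lazy initialisation), and every write changes a single cell (`Function.update`). -/

/-- A possibly divergent computation with result in `α` and a step count. -/
structure Timed (α : Type) where
  part : Part (α × ℕ)

namespace Timed

noncomputable instance : Monad Timed where
  pure a := ⟨Part.some (a, 0)⟩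
  bind x f := ⟨x.part.bind fun p => (f p.1).part.map fun q => (q.1, p.2 + q.2)⟩

/-- The computation `x` terminates with value `a` after exactly `c` elementary steps. -/
def Runs {α : Type} (x : Timed α) (a : α) (c : ℕ) : Prop := (a, c) ∈ x.part

/-- One elementary step with result `a`. -/
def step {α : Type} (a : α) : Timed α := ⟨Part.some (a, 1)⟩

/-- One iteration of a loop, on pairs of a state and the number of steps executed so far. -/
noncomputable def loopBody {σ α : Type} (body : σ → Timed (α ⊕ σ)) :
    σ × ℕ →. (α × ℕ) ⊕ (σ × ℕ) :=
  fun p => (body p.1).part.map fun q =>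
    Sum.map (fun a => (a, p.2 + q.2)) (fun s' => (s', p.2 + q.2)) q.1

/-- Unbounded loop: `body s` either ends the loop with a result (`Sum.inl`) or asks for another
iteration from a new state (`Sum.inr`).  The steps of all iterations are added up; the loop has no
value if it does not terminate. -/
noncomputable def loop {σ α : Type} (body : σ → Timed (α ⊕ σ)) (s : σ) : Timed α :=
  ⟨(loopBody body).fix (s, 0)⟩

/-- `for i in l do s := f s i`, with one step of loop overhead per element and one at the end. -/
noncomputable def forEach {ι σ : Type} : List ι → σ → (σ → ι → Timed σ) → Timed σ
  | [], s, _ => step s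
  | i :: l, s, f => do
      let s ← step s
      let s' ← f s i
      forEach l s' f

end Timed

open Timed in
/-- The least `L` with `n ≤ (1 + ε) ^ L`, that is `⌈log_{1+ε} n⌉`, by repeated multiplication. -/
noncomputable def levelCount (ε : ℝ) (n : ℕ) : Timed ℕ :=
  loop (fun p : ℕ × ℝ =>
    step (if (n : ℝ) ≤ p.2 then Sum.inl p.1 else Sum.inr (p.1 + 1, p.2 * (1 + ε)))) (0, 1)

/-! ### Incremental approximate densest subgraph

The state stores the current graph `H` (whose vertices are the endpoints of the inserted edges) and
a nested family of vertex sets `S 0 ⊇ S 1 ⊇ ⋯ ⊇ S L`, encoded by levels: `v ∈ S t ↔ t ≤ lvl v`. -/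

/-- State of one instance of the incremental densest-subgraph algorithm. -/
structure DensState (V : Type) where
  /-- the vertices of `H` -/
  verts : List V
  /-- adjacency lists of `H` -/
  adj : V → List V
  /-- edge table of `H` -/
  hasEdge : V → V → Bool
  /-- level of each vertex -/
  lvl : V → ℕ
  /-- `cnt v t` is the number of neighbours of `v` in `S t` -/
  cnt : V → ℕ → ℕ
  /-- current guess for the optimal density -/
  β : ℝ
  /-- vertex set of the maintained subgraph -/
  sol : List V
  /-- density of the maintained subgraph when it was computed -/
  dens : ℝ

namespace ApprDens

open Timed

variable {V : Type} [DecidableEq V]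

/-- Increment the single cell `c w t`. -/
def bump (c : V → ℕ → ℕ) (w : V) (t : ℕ) : V → ℕ → ℕ :=
  Function.update c w (Function.update (c w) t (c w t + 1))

/-- The empty graph. -/
noncomputable def init (ε : ℝ) : Timed (DensState V) :=
  step
    { verts := [], adj := fun _ => [], hasEdge := fun _ _ => false, lvl := fun _ => 0,
      cnt := fun _ _ => 0, β := 1 / (4 * (1 + ε)), sol := [], dens := 0 }

/-- What a run of `find` computes: the levels, and the densest set met with its density. -/
structure FindResult (V : Type) where
  lvl : V → ℕ
  sol : List V
  dens : ℝ

/-- At most `R` further peeling rounds, starting with round `t` and the remaining vertices `S`: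
record `S` as level `t`, compute the degrees in the subgraph induced by `S` and its density, and keep
the vertices of degree at least `thr`. -/
noncomputable def findRounds (adj : V → List V) (thr : ℝ) :
    ℕ → ℕ → List V → FindResult V → Timed (FindResult V)
  | 0, _, _, res => step res
  | R + 1, t, S, res => do
      if ← step S.isEmpty then
        pure res
      else
        let lvl ← forEach S res.lvl fun lvl v => step (Function.update lvl v t)
        let (num, sum, keep) ← forEach S ((0, 0, []) : ℕ × ℕ × List V) fun acc v => do
          let d ← forEach (adj v) (0 : ℕ) fun d w => step (if lvl w = t then d + 1 else d)
          step (acc.1 + 1, acc.2.1 + d, if thr ≤ (d : ℝ) then v :: acc.2.2 else acc.2.2)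
        let ρ ← step ((sum : ℝ) / (2 * (num : ℝ)))
        let res' ← step
          (if res.dens < ρ then { lvl := lvl, sol := S, dens := ρ } else { res with lvl := lvl })
        findRounds adj thr R (t + 1) keep res'

/-- Peel the graph repeatedly with threshold `2(1+ε)β` (rounds `0, …, L`, or until nothing is left)
and return the densest of the sets met. -/
noncomputable def find (ε : ℝ) (L : ℕ) (D : DensState V) (β : ℝ) : Timed (FindResult V) := do
  let thr ← step (2 * (1 + ε) * β)
  let res ← step { lvl := D.lvl, sol := [], dens := 0 }
  findRounds D.adj thr (L + 1) 0 D.verts res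

/-- Call `find` with growing `β` for as long as it returns a subgraph of density at least `β`; keep
the last subgraph of this kind, and the levels of the last call. -/
noncomputable def findDensest (ε : ℝ) (L : ℕ) (D₀ : DensState V) : Timed (DensState V) :=
  loop (fun D : DensState V => do
    let res ← find ε L D D.β
    if ← step (decide (D.β ≤ res.dens)) then
      step (Sum.inr { D with β := (1 + ε) * res.dens, sol := res.sol, dens := res.dens })
    else
      step (Sum.inl { D with lvl := res.lvl })) D₀

/-- Recompute the solution and the levels, and then all counters. -/
noncomputable def rebuild (ε : ℝ) (L : ℕ) (D₀ : DensState V) : Timed (DensState V) := do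
  let D ← findDensest ε L D₀
  let zeroed ← forEach D.verts D.cnt fun c v =>
    forEach (List.range (L + 1)) c fun c t =>
      step (Function.update c v (Function.update (c v) t 0))
  let cnt ← forEach D.verts zeroed fun c v =>
    forEach (D.adj v) c fun c w =>
      forEach (List.range (D.lvl v + 1)) c fun c t => step (bump c w t)
  step { D with cnt := cnt }

/-- Add the new edge `{u, v}` to the vertex list, the adjacency lists, the edge table and the
counters. -/
noncomputable def link (D : DensState V) (u v : V) : Timed (DensState V) := do
  let verts ← step (if (D.adj u).isEmpty then u :: D.verts else D.verts)
  let verts ← step (if (D.adj v).isEmpty then v :: verts else verts)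
  let adj ← step (Function.update D.adj u (v :: D.adj u))
  let adj ← step (Function.update adj v (u :: adj v))
  let tab ← step (Function.update D.hasEdge u (Function.update (D.hasEdge u) v true))
  let tab ← step (Function.update tab v (Function.update (tab v) u true))
  let cnt ← forEach (List.range (D.lvl v + 1)) D.cnt fun c t => step (bump c u t)
  let cnt ← forEach (List.range (D.lvl u + 1)) cnt fun c t => step (bump c v t)
  step { D with verts := verts, adj := adj, hasEdge := tab, cnt := cnt }

/-- The first `t' ≥ t` with `c t' < thr`, or `t + R` if there is none below `t + R`. -/
noncomputable def nextLevel (c : ℕ → ℕ) (thr : ℝ) : ℕ → ℕ → Timed ℕ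
  | 0, t => step t
  | R + 1, t => do
      if ← step (decide ((c t : ℝ) < thr)) then pure t else nextLevel c thr R (t + 1)

/-- Restore the property that every vertex `s` has fewer than `2(1+ε)β` neighbours in `S (lvl s)`,
working off a stack of vertices to be checked.  A vertex that violates it is lifted, and its
neighbours are pushed.  The Boolean answer tells whether some vertex would have to be lifted to level
`L`, in which case everything has to be rebuilt. -/
noncomputable def propagate (ε : ℝ) (L : ℕ) (D₀ : DensState V) (stack₀ : List V) :
    Timed (Bool × DensState V) :=
  loop (fun p : List V × DensState V =>
    match p with
    | ([], D) => step (Sum.inl (false, D))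
    | (s :: stack, D) => do
        let thr ← step (2 * (1 + ε) * D.β)
        let t ← step (D.lvl s)
        if ← step (decide ((D.cnt s t : ℝ) < thr)) then
          step (Sum.inr (stack, D))
        else
          let t' ← nextLevel (D.cnt s) thr (L - (t + 1)) (t + 1)
          if ← step (decide (L ≤ t')) then
            step (Sum.inl (true, D))
          else
            let lvl ← step (Function.update D.lvl s t')
            let (stack, cnt) ← forEach (D.adj s) (stack, D.cnt) fun q w => do
              let c ← forEach (List.range' (t + 1) (t' - t)) q.2 fun c j => step (bump c w j)
              step (w :: q.1, c)
            step (Sum.inr (stack, { D with lvl := lvl, cnt := cnt }))) (stack₀, D₀)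

/-- Insertion of the edge `{u, v}`. -/
noncomputable def insert (ε : ℝ) (L : ℕ) (D : DensState V) (u v : V) : Timed (DensState V) := do
  if ← step (D.hasEdge u v) then
    pure D
  else
    let D ← link D u v
    let (again, D) ← propagate ε L D [u, v]
    if ← step again then rebuild ε L D else pure D

/-- Insertion of a list of edges, one after the other. -/
noncomputable def insertAll (ε : ℝ) (L : ℕ) (D : DensState V) (es : List (V × V)) :
    Timed (DensState V) :=
  forEach es D fun D e => insert ε L D e.1 e.2

end ApprDens

/-! ### Temporal graphs -/

/-- A temporal graph on the vertex set `V` with time stamps `1, …, r`: `τ u v t` tells whether the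
(undirected) edge `{u, v}` exists at time `t`. -/
structure TemporalGraph (V : Type) where
  r : ℕ
  τ : V → V → ℕ → Bool
  symm : ∀ u v t, τ u v t = τ v u t
  loopless : ∀ v t, τ v v t = false

namespace TemporalGraph

variable {V : Type}

/-- The set of edges that exist at time `t`. -/
def edgesAt (G : TemporalGraph V) (t : ℕ) : Set (Sym2 V) :=
  {e | ∃ u v, e = s(u, v) ∧ G.τ u v t = true}

/-- The number `m` of temporal edges. -/
noncomputable def numEdges (G : TemporalGraph V) : ℕ :=
  ∑ t ∈ Finset.Icc 1 G.r, (G.edgesAt t).ncard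

/-- The input format of the algorithm: for every time stamp, a list of the edges that exist then,
each of them once, in some order and orientation. -/
structure EdgeListing (G : TemporalGraph V) where
  edges : ℕ → List (V × V)
  nodup : ∀ t ∈ Finset.Icc 1 G.r, ((edges t).map fun e => s(e.1, e.2)).Nodup
  mem_iff : ∀ t ∈ Finset.Icc 1 G.r, ∀ e : Sym2 V,
    e ∈ (edges t).map (fun e => s(e.1, e.2)) ↔ e ∈ G.edgesAt t

end TemporalGraph

/-! ### Approximate dynamic programming with incremental densest subgraphs -/

namespace ApproxDP

open Timed

variable {V : Type}

/-- Sparsification of the candidate list `a :: A`: walk along it, and delete the middle one of three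
consecutive candidates `a, b, c` whenever `f c - f a ≤ δ`.  A candidate carries its own instance of
the incremental densest-subgraph algorithm, which is dropped together with it. -/
noncomputable def sprsFrom (f : ℕ → ℝ) (δ : ℝ) :
    ℕ × DensState V → List (ℕ × DensState V) → Timed (List (ℕ × DensState V))
  | a, [] => step [a]
  | a, [b] => step [a, b]
  | a, b :: c :: A => do
      if ← step (decide (f c.1 - f a.1 ≤ δ)) then
        sprsFrom f δ a (c :: A)
      else
        let A' ← sprsFrom f δ b (c :: A)
        step (a :: A')

/-- Sparsification of a candidate list. -/
noncomputable def sprs (f : ℕ → ℝ) (δ : ℝ) :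
    List (ℕ × DensState V) → Timed (List (ℕ × DensState V))
  | [] => step []
  | a :: A => sprsFrom f δ a A

/-- Write the single cell `s[i, ℓ]` of the profit table. -/
def setCell (s : ℕ → ℕ → ℝ) (i ℓ : ℕ) (x : ℝ) : ℕ → ℕ → ℝ :=
  Function.update s i (Function.update (s i) ℓ x)

variable [DecidableEq V]

/-- `s[i, 1]` for `i = 1, …, r`: one instance that receives all edges. -/
noncomputable def firstColumn (ε : ℝ) (L r : ℕ) (E : ℕ → List (V × V)) (s : ℕ → ℕ → ℝ) :
    Timed (ℕ → ℕ → ℝ) := do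
  let D ← ApprDens.init (V := V) ε
  let out ← forEach (List.range' 1 r) (s, D) fun p i => do
    let D ← ApprDens.insertAll ε L p.2 (E i)
    let s ← step (setCell p.1 i 1 D.dens)
    pure (s, D)
  pure out.1

/-- Round `i` of the computation of column `ℓ`.  The candidate `i` is added to the list `A`; the
edges at time `i` are inserted into the instances of all candidates, and `s[i, ℓ]` becomes the
maximum of `s[i-1, ℓ]`, `s[i, ℓ-1]` and all `s[a-1, ℓ-1] + d([a, i])`; then `A` is sparsified, where
the values compared are `s[a - shift, ℓ-1]`. -/
noncomputable def round (shift : ℕ) (ε₁ ε : ℝ) (k L : ℕ) (E : ℕ → List (V × V)) (ℓ : ℕ)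
    (s : ℕ → ℕ → ℝ) (A : List (ℕ × DensState V)) (i : ℕ) :
    Timed ((ℕ → ℕ → ℝ) × List (ℕ × DensState V)) := do
  let D ← ApprDens.init ε
  let A ← step (A ++ [(i, D)])
  let x₀ ← step (max (s (i - 1) ℓ) (s i (ℓ - 1)))
  let (A, x) ← forEach A (([] : List (ℕ × DensState V)), x₀) fun p c => do
    let D ← ApprDens.insertAll ε L c.2 (E i)
    step (p.1 ++ [(c.1, D)], max p.2 (s (c.1 - 1) (ℓ - 1) + D.dens))
  let s ← step (setCell s i ℓ x)
  let δ ← step (x * (ε₁ / ((k : ℝ) + (ℓ : ℝ) * ε₁)))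
  let A ← sprs (fun a => s (a - shift) (ℓ - 1)) δ A
  pure (s, A)

/-- The whole algorithm.  It returns the profit table `s`, where `s i ℓ` is `s[i, ℓ]`.  The
densest-subgraph algorithm is run with the internal accuracy `ε = min ε₂ 1 / 3`, for which its
approximation factor `2(1+ε)²` is at most `2(1+ε₂)`. -/
noncomputable def run (shift : ℕ) (ε₁ ε₂ : ℝ) (k n r : ℕ) (E : ℕ → List (V × V)) :
    Timed (ℕ → ℕ → ℝ) := do
  let ε ← step (min ε₂ 1 / 3)
  let L ← levelCount ε n
  let s ← step fun _ _ => (0 : ℝ)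
  let s ← firstColumn ε L r E s
  forEach (List.range' 2 (k - 1)) s fun s ℓ => do
    let out ← forEach (List.range' 1 r) (s, ([] : List (ℕ × DensState V))) fun p i =>
      round shift ε₁ ε k L E ℓ p.1 p.2 i
    pure out.1

end ApproxDP

/-! The running time is the number of columns, times the number of candidates alive at once, times
the number of edges, times the amortized cost of one insertion. Only running time, not approximation
quality, is at stake, so few facts about the computed values are needed.

Insertion costs O(L²) amortized (`wp_insert`), by the potential `20 · ∑ deg(v)(L - lvl v) + 100 · L
· ∑ deg(v) · gap(β)`. Lifting a vertex by Δ levels costs O(deg · Δ), which the first term releases.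
The second term pays for rebuilds: `gap` bounds how often β can still grow by a factor 1 + ε, and it
is O(L), because β starts at a constant, densities are at most n/2 and n ≤ (1+ε)^L. A new edge
raises the potential by O(L²).

The crux is that every rebuild increases β at least once (`levels_of_find_lt`). If the first peeling
found nothing of density β, every round would shrink the vertex set by a factor exceeding 1 + ε, so
that no vertex could reach level L. But peeling gives pointwise the largest levels compatible with
the degree condition (field `dominate` of `FindPost`), and the lift that triggered the rebuild
exhibits compatible levels reaching L. So `gap` drops with every peeling of a rebuild except the
last, and at least once.

Sparsification leaves O(k/ε₁) candidates (`wp_sprsFrom`, `length_le_of_gap`): values of survivors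
two apart differ by more than δ, and all values lie in [0, s[i,ℓ]], so telescoping gives (|A| - 2)δ
< 2 s[i,ℓ]. This uses that columns are monotone, which holds even though the densities are only
approximate. Deleted instances merely discard potential, and new ones start with none.

With L = O(log n / ε₂), k columns and O(k/ε₁) instances per edge give the bound. -/

namespace Timed

/-! ### Total-correctness rules for step-counted computations -/

/-- `x` terminates, with a result and a number of steps that satisfy `Q`. -/
def wp {α : Type} (x : Timed α) (Q : α → ℕ → Prop) : Prop := ∃ a c, x.Runs a c ∧ Q a c

theorem wp.mono {α : Type} {x : Timed α} {P Q : α → ℕ → Prop} (h : wp x P)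
    (hPQ : ∀ a c, P a c → Q a c) : wp x Q := by
  obtain ⟨a, c, hr, hp⟩ := h
  exact ⟨a, c, hr, hPQ a c hp⟩

@[simp] theorem wp_step {α : Type} (a : α) (Q : α → ℕ → Prop) : wp (step a) Q ↔ Q a 1 := by
  simp [wp, Runs, step]

@[simp] theorem wp_pure {α : Type} (a : α) (Q : α → ℕ → Prop) :
    wp (pure a : Timed α) Q ↔ Q a 0 := by
  simp [wp, Runs, pure]

@[simp] theorem wp_bind {α β : Type} (x : Timed α) (f : α → Timed β) (Q : β → ℕ → Prop) :
    wp (x >>= f) Q ↔ wp x fun a c => wp (f a) fun b d => Q b (c + d) := by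
  simp only [wp, Runs, bind, Part.mem_bind_iff, Part.mem_map_iff]
  constructor
  · rintro ⟨b, e, ⟨⟨a, c⟩, ha, ⟨b', d⟩, hb, hbe⟩, hQ⟩
    obtain ⟨rfl, rfl⟩ := Prod.mk.inj hbe
    exact ⟨a, c, ha, b', d, hb, hQ⟩
  · rintro ⟨a, c, ha, b, d, hb, hQ⟩
    exact ⟨b, c + d, ⟨⟨a, c⟩, ha, ⟨b, d⟩, hb, rfl⟩, hQ⟩

theorem wp_ite {α : Type} (p : Prop) [Decidable p] (x y : Timed α) (Q : α → ℕ → Prop)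
    (h₁ : p → wp x Q) (h₂ : ¬p → wp y Q) : wp (if p then x else y) Q := by
  split_ifs with h
  exacts [h₁ h, h₂ h]

/-- Invariant rule for `forEach`: `I done s c` holds when the elements of `done` have been processed,
in `c` steps. -/
theorem wp_forEach {ι σ : Type} {l : List ι} {s : σ} {f : σ → ι → Timed σ} {Q : σ → ℕ → Prop}
    (I : List ι → σ → ℕ → Prop) (h0 : I [] s 0)
    (hstep : ∀ done i rest s c, l = done ++ i :: rest → I done s c →
      wp (f s i) fun s' d => I (done ++ [i]) s' (c + d + 1))
    (hQ : ∀ s c, I l s c → Q s (c + 1)) : wp (forEach l s f) Q := by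
  suffices H : ∀ (rest done : List ι) (s : σ) (c : ℕ), l = done ++ rest → I done s c →
      wp (forEach rest s f) fun s' d => Q s' (c + d) by
    simpa using H l [] s 0 rfl h0
  intro rest
  induction rest with
  | nil =>
    intro done s c hl hI
    simp only [List.append_nil] at hl
    subst hl
    simpa [forEach] using hQ s c hI
  | cons i rest ih =>
    intro done s c hl hI
    simp only [forEach, wp_bind, wp_step]
    refine (hstep done i rest s c hl hI).mono fun s' d hI' => ?_
    refine (ih (done ++ [i]) s' _ (by simp [hl]) hI').mono fun s'' e hq => ?_
    convert hq using 1
    omega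

/-- Loops whose bodies have a known result and a known cost for each element. -/
theorem wp_forEach_foldl {ι σ : Type} {l : List ι} {s : σ} {f : σ → ι → Timed σ}
    {Q : σ → ℕ → Prop} (g : σ → ι → σ) (b : ι → ℕ)
    (hf : ∀ s i, i ∈ l → wp (f s i) fun s' d => s' = g s i ∧ d = b i)
    (hQ : Q (l.foldl g s) ((l.map fun i => b i + 1).sum + 1)) : wp (forEach l s f) Q := by
  refine wp_forEach
    (fun done s' c => s' = done.foldl g s ∧ c = (done.map fun i => b i + 1).sum) (by simp) ?_ ?_
  · rintro done i rest s' c hl ⟨rfl, rfl⟩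
    refine (hf _ i (by simp [hl])).mono ?_
    rintro s'' d ⟨rfl, rfl⟩
    simp [add_assoc]
  · rintro s' c ⟨rfl, rfl⟩
    exact hQ

/-- The measure `μ` yields termination, hence a value of the partial fixed point; the invariant `I`
also carries the steps already spent. -/
theorem wp_loop {σ α : Type} {body : σ → Timed (α ⊕ σ)} {s : σ} {Q : α → ℕ → Prop}
    (I : σ → ℕ → Prop) (μ : σ → ℕ) (h0 : I s 0)
    (hstep : ∀ s c, I s c → wp (body s) fun r d =>
      Sum.elim (fun a => Q a (c + d)) (fun s' => I s' (c + d) ∧ μ s' < μ s) r) :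
    wp (loop body s) Q := by
  suffices H : ∀ (N : ℕ) (s : σ) (c : ℕ), μ s < N → I s c →
      ∃ a d, (a, d) ∈ (loopBody body).fix (s, c) ∧ Q a d from H _ s 0 (Nat.lt_succ_self _) h0
  intro N
  induction N with
  | zero => intro s c h; omega
  | succ N ih =>
    intro s c hN hI
    obtain ⟨r, d, hr, hQ⟩ := hstep s c hI
    rcases r with a | s'
    · refine ⟨a, c + d, PFun.mem_fix_iff.2 (Or.inl ?_), hQ⟩
      exact (Part.mem_map_iff _).2 ⟨_, hr, rfl⟩
    · obtain ⟨hI', hlt⟩ := hQ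
      obtain ⟨a, e, ha, hq⟩ := ih s' (c + d) (by omega) hI'
      refine ⟨a, e, PFun.mem_fix_iff.2 (Or.inr ⟨(s', c + d), ?_, ha⟩), hq⟩
      exact (Part.mem_map_iff _).2 ⟨_, hr, rfl⟩

end Timed

/-! ### Peeling rounds -/

namespace ApprDens

open Timed

variable {V : Type}

/-- The sum of all degrees. -/
def vol [Fintype V] (adj : V → List V) : ℕ := ∑ v, (adj v).length

/-- The number of neighbours of `v` of level at least `t`. -/
def upDeg (adj : V → List V) (lvl : V → ℕ) (v : V) (t : ℕ) : ℕ :=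
  (adj v).countP fun w => decide (t ≤ lvl w)

theorem upDeg_mono {adj : V → List V} {lvl lvl' : V → ℕ} {v : V} {t t' : ℕ}
    (h : ∀ w ∈ adj v, t ≤ lvl w → t' ≤ lvl' w) : upDeg adj lvl v t ≤ upDeg adj lvl' v t' :=
  List.countP_mono_left fun w hw hp => by simpa using h w hw (by simpa using hp)

theorem foldl_degrees (thr : ℝ) (d : V → ℕ) (S : List V) (a b : ℕ) (K : List V) :
    S.foldl (fun (acc : ℕ × ℕ × List V) v => (acc.1 + 1, acc.2.1 + d v,
      if thr ≤ (d v : ℝ) then v :: acc.2.2 else acc.2.2)) (a, b, K) =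
    (a + S.length, b + (S.map d).sum, (S.filter fun v => decide (thr ≤ (d v : ℝ))).reverse ++ K) := by
  induction S generalizing a b K with
  | nil => simp
  | cons v S ih =>
    rw [List.foldl_cons, ih]
    by_cases h : thr ≤ (d v : ℝ) <;> simp [h, add_assoc, add_comm] <;> omega

variable [DecidableEq V]

theorem sum_map_le_sum_univ [Fintype V] {S : List V} (hS : S.Nodup) (g : V → ℕ) :
    (S.map g).sum ≤ ∑ v, g v := by
  rw [← List.sum_toFinset g hS]
  exact Finset.sum_le_sum_of_subset (Finset.subset_univ _)

/-- Each listed vertex has degree at least 1; this lets the cost per vertex be charged to edges. -/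
theorem length_le_vol [Fintype V] {adj : V → List V} {S : List V} (hS : S.Nodup)
    (h : ∀ v ∈ S, adj v ≠ []) : S.length ≤ vol adj := by
  refine le_trans ?_ (sum_map_le_sum_univ hS fun v => (adj v).length)
  have : (S.map fun _ => 1).sum ≤ (S.map fun v => (adj v).length).sum :=
    List.sum_le_sum fun v hv => List.length_pos_iff.2 (h v hv)
  simpa using this

theorem foldl_update_const (S : List V) (lvl : V → ℕ) (t : ℕ) (w : V) :
    S.foldl (fun lvl v => Function.update lvl v t) lvl w = if w ∈ S then t else lvl w := by
  induction S generalizing lvl with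
  | nil => simp
  | cons v S ih =>
    rw [List.foldl_cons, ih]
    by_cases h1 : w ∈ S
    · simp [h1]
    · by_cases h2 : w = v
      · subst h2; simp
      · simp [h1, h2]

/-- What is known of the result of peeling rounds `t, …, t + R - 1` from the set `S`. -/
structure FindPost [Fintype V] (adj : V → List V) (ε β : ℝ) (R t : ℕ) (S : List V)
    (res res' : FindResult V) : Prop where
  not_mem : ∀ w ∉ S, res'.lvl w = res.lvl w
  -- Level `t - 1` occurs for `R = 0`, when `S` is never recorded as level `t`.
  le_succ : ∀ w ∈ S, t ≤ res'.lvl w + 1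
  deg : ∀ w ∈ S, t < res'.lvl w → 2 * (1 + ε) * β ≤ (upDeg adj res'.lvl w (res'.lvl w - 1) : ℝ)
  shrink : res'.dens < β → ∀ w ∈ S, t < res'.lvl w →
    (1 + ε) ^ (res'.lvl w - t) < (S.length : ℝ)
  -- Maximality: peeling never discards a vertex that another family obeying the degree condition
  -- would keep.
  dominate : ∀ l : V → ℕ,
    (∀ v, 0 < l v → 2 * (1 + ε) * β ≤ (upDeg adj l v (l v - 1) : ℝ)) →
    (∀ w, adj w ≠ [] → t ≤ l w → w ∈ S) →
    ∀ w, adj w ≠ [] → t ≤ l w → l w < t + R → l w ≤ res'.lvl w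
  dens_le : res.dens ≤ res'.dens
  le_dens : res'.dens ≤ max res.dens ((Fintype.card V : ℝ) / 2)

/-- Induction on the remaining rounds. `h₁` excludes stale levels: outside `S` no non-isolated
vertex has level `t` or more, so the test `lvl w = t` recognises membership in `S`. In round 0 this
holds because `S` contains all non-isolated vertices and their old levels are overwritten. -/
theorem wp_findRounds [Fintype V] {adj : V → List V} {ε β : ℝ} (hε : 0 < ε) (hβ : 0 < β)
    (hsymm : ∀ v w, w ∈ adj v → v ∈ adj w) (hnodup : ∀ v, (adj v).Nodup)
    (R t : ℕ) (S : List V) (res : FindResult V) (hS : S.Nodup) (hSadj : ∀ v ∈ S, adj v ≠ [])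
    (h₁ : ∀ w, adj w ≠ [] → (w ∈ S ∧ 0 < R) ∨ res.lvl w < t)
    (h₂ : ∀ w ∈ S, t ≤ res.lvl w + 1) :
    wp (findRounds adj (2 * (1 + ε) * β) R t S res) fun res' c =>
      c ≤ 12 * vol adj * R + 1 ∧ FindPost adj ε β R t S res res' := by
  induction R generalizing t S res with
  | zero =>
    have h₁' : ∀ w ∈ S, res.lvl w < t := fun w hw => by simpa using h₁ w (hSadj w hw)
    simp only [findRounds, wp_step]
    refine ⟨by omega, by simp, h₂, ?_, ?_, ?_, le_rfl, le_max_left _ _⟩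
    · intro w hw h; have := h₁' w hw; omega
    · intro _ w hw h; have := h₁' w hw; omega
    · intros; omega
  | succ R ih =>
    rw [findRounds]
    simp only [wp_bind, wp_step]
    refine wp_ite _ _ _ _ (fun hemp => ?_) (fun hemp => ?_)
    · have hnil : S = [] := by simpa using hemp
      subst hnil
      simp only [wp_pure]
      refine ⟨by omega, by simp, by simp, by simp, by simp, ?_, le_rfl, le_max_left _ _⟩
      intro l _ hl w hw htl
      simpa using hl w hw htl
    have hne : S ≠ [] := by simpa using hemp
    set lvl := S.foldl (fun lvl v => Function.update lvl v t) res.lvl with hlvl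
    have hlvl_apply : ∀ w, lvl w = if w ∈ S then t else res.lvl w :=
      foldl_update_const S res.lvl t
    set d : V → ℕ := fun v => (adj v).countP fun w => decide (lvl w = t) with hd
    set keep := (S.filter fun v => decide (2 * (1 + ε) * β ≤ (d v : ℝ))).reverse with hkeep
    have hmem_keep : ∀ w, w ∈ keep ↔ w ∈ S ∧ 2 * (1 + ε) * β ≤ (d w : ℝ) := by
      intro w; simp [hkeep]
    simp only [wp_bind]
    refine wp_forEach_foldl (fun lvl v => Function.update lvl v t) (fun _ => 1)
      (by intro s i _; simp) ?_
    refine wp_forEach_foldl (fun (acc : ℕ × ℕ × List V) v => (acc.1 + 1, acc.2.1 + d v,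
      if 2 * (1 + ε) * β ≤ (d v : ℝ) then v :: acc.2.2 else acc.2.2))
      (fun v => 2 * (adj v).length + 2) ?_ ?_
    · intro acc v _
      simp only [wp_bind, wp_step]
      refine wp_forEach_foldl (fun d w => if lvl w = t then d + 1 else d) (fun _ => 1)
        (by intro s i _; simp [hlvl]) ?_
      have : ∀ (l : List V) (a : ℕ), l.foldl (fun d w => if lvl w = t then d + 1 else d) a =
          a + l.countP fun w => decide (lvl w = t) := by
        intro l
        induction l with
        | nil => simp
        | cons x l ihl =>
          intro a
          rw [List.foldl_cons, ihl, List.countP_cons]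
          by_cases h : lvl x = t <;> simp [h]; omega
      rw [this]
      simp [hd]
      omega
    rw [foldl_degrees]
    simp only [wp_step, List.append_nil, zero_add]
    rw [← hkeep]
    set ρ : ℝ := ((S.map d).sum : ℕ) / (2 * (S.length : ℝ)) with hρ
    have hlen : (0 : ℝ) < S.length := by exact_mod_cast List.length_pos_iff.2 hne
    set res₁ : FindResult V :=
      if res.dens < ρ then { lvl := lvl, sol := S, dens := ρ } else { res with lvl := lvl }
      with hres₁
    have hres₁_lvl : res₁.lvl = lvl := by rw [hres₁]; split_ifs <;> rfl
    have hres₁_dens : res₁.dens = max res.dens ρ := by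
      rw [hres₁]; split_ifs with h
      · exact (max_eq_right h.le).symm
      · exact (max_eq_left (not_lt.1 h)).symm
    have hdeg : ∀ v, d v = upDeg adj (fun w => if w ∈ S then 1 else 0) v 1 := by
      intro v
      simp only [hd, upDeg]
      refine List.countP_congr fun w hw => ?_
      have hw' : adj w ≠ [] := List.ne_nil_of_mem (hsymm v w hw)
      simp only [decide_eq_true_eq, hlvl_apply]
      by_cases h : w ∈ S
      · simp [h]
      · have := h₁ w hw'
        simp only [h, false_and, false_or] at this
        simp [h]; omega
    have hd_card : ∀ v, d v ≤ Fintype.card V := fun v =>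
      le_trans List.countP_le_length (hnodup v).length_le_card
    have hρ_le : ρ ≤ (Fintype.card V : ℝ) / 2 := by
      rw [hρ, div_le_div_iff₀ (by positivity) (by norm_num)]
      have h : (S.map d).sum ≤ S.length * Fintype.card V := by
        have := List.sum_le_card_nsmul (S.map d) (Fintype.card V) (by
          intro x hx; obtain ⟨v, _, rfl⟩ := List.mem_map.1 hx; exact hd_card v)
        simpa using this
      have h' : (((S.map d).sum : ℕ) : ℝ) ≤ S.length * Fintype.card V := by exact_mod_cast h
      nlinarith
    -- Markov's inequality for degrees: the degree sum of `S` is at least the threshold times the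
    -- number of surviving vertices.
    have hkeep_sum : (2 * (1 + ε) * β) * (keep.length : ℝ) ≤ ((S.map d).sum : ℕ) := by
      have h1 : ((keep.map d).sum : ℕ) ≤ (S.map d).sum := by
        rw [hkeep, List.map_reverse, List.sum_reverse]
        exact (List.filter_sublist.map d).sum_le_sum (by simp)
      have h2 : (2 * (1 + ε) * β) * (keep.length : ℝ) ≤ ((keep.map d).sum : ℕ) := by
        have h3 : ∀ l : List V, (∀ w ∈ l, 2 * (1 + ε) * β ≤ (d w : ℝ)) →
            (2 * (1 + ε) * β) * (l.length : ℝ) ≤ ((l.map d).sum : ℕ) := by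
          intro l
          induction l with
          | nil => simp
          | cons x l ihl =>
            intro hl
            have ha := hl x (by simp)
            have hb := ihl fun w hw => hl w (by simp [hw])
            simp only [List.length_cons, List.map_cons, List.sum_cons]
            push_cast at hb ⊢
            linarith
        exact h3 keep fun w hw => ((hmem_keep w).1 hw).2
      exact h2.trans (by exact_mod_cast h1)
    have hkeep_nodup : keep.Nodup := List.nodup_reverse.2 (hS.filter _)
    refine (ih (t + 1) keep res₁ hkeep_nodup (fun v hv => hSadj v ((hmem_keep v).1 hv).1)
      ?_ ?_).mono ?_
    · intro w hw
      right
      rw [hres₁_lvl, hlvl_apply]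
      split_ifs with h
      · omega
      · have := h₁ w hw
        simp only [h, false_and, false_or] at this
        omega
    · intro w hw
      rw [hres₁_lvl, hlvl_apply, if_pos ((hmem_keep w).1 hw).1]
    rintro res' c ⟨hc, post⟩
    have hlow : ∀ w ∈ S, t ≤ res'.lvl w := by
      intro w hw
      by_cases hk : w ∈ keep
      · have := post.le_succ w hk; omega
      · rw [post.not_mem w hk, hres₁_lvl, hlvl_apply, if_pos hw]
    have hkeep_of_lt : ∀ w ∈ S, t < res'.lvl w → w ∈ keep := by
      intro w hw hlt
      by_contra hk
      rw [post.not_mem w hk, hres₁_lvl, hlvl_apply, if_pos hw] at hlt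
      omega
    refine ⟨?_, ?_, ?_, ?_, ?_, ?_, ?_, ?_⟩
    · have hvol : 1 ≤ vol adj :=
        le_trans (List.length_pos_iff.2 hne) (length_le_vol hS hSadj)
      have hlen := length_le_vol hS hSadj
      have hsum := sum_map_le_sum_univ hS fun v => (adj v).length
      rw [← vol] at hsum
      have e1 : (S.map fun i => 2 * (adj i).length + 2 + 1).sum =
          2 * (S.map fun v => (adj v).length).sum + 3 * S.length := by
        clear_value d
        clear * -
        induction S with
        | nil => simp
        | cons x S ihS => simp only [List.map_cons, List.sum_cons, ihS, List.length_cons]; ring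
      rw [e1]
      simp only [List.map_const', List.sum_replicate, smul_eq_mul]
      nlinarith
    · intro w hw
      rw [post.not_mem w fun hk => hw ((hmem_keep w).1 hk).1, hres₁_lvl, hlvl_apply, if_neg hw]
    · intro w hw; have := hlow w hw; omega
    · intro w hw hlt
      have hk := hkeep_of_lt w hw hlt
      by_cases h : t + 1 < res'.lvl w
      · exact post.deg w hk h
      · have he : res'.lvl w = t + 1 := by omega
        refine ((hmem_keep w).1 hk).2.trans ?_
        rw [hdeg, he]
        exact Nat.cast_le.2 (upDeg_mono fun x _ hx => by
          have : x ∈ S := by by_contra h; simp [h] at hx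
          simpa using hlow x this)
    · intro hfail w hw hlt
      have hk := hkeep_of_lt w hw hlt
      have hρβ : ρ < β := lt_of_le_of_lt ((le_max_right _ _).trans
        (hres₁_dens.symm.le.trans post.dens_le)) hfail
      -- The degree sum is 2ρ|S| < 2β|S|, and it is at least 2(1+ε)β|keep|.
      have hlt' : (1 + ε) * (keep.length : ℝ) < S.length := by
        rw [hρ, div_lt_iff₀ (by positivity)] at hρβ
        have : 2 * β * ((1 + ε) * (keep.length : ℝ)) < 2 * β * S.length := by nlinarith
        exact lt_of_mul_lt_mul_left this (by positivity)
      by_cases h : t + 1 < res'.lvl w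
      · have := post.shrink hfail w hk h
        have he : res'.lvl w - t = (res'.lvl w - (t + 1)) + 1 := by omega
        rw [he, pow_succ]
        nlinarith
      · have he : res'.lvl w - t = 1 := by omega
        have hk1 : (1 : ℝ) ≤ keep.length := by
          exact_mod_cast List.length_pos_iff.2 (List.ne_nil_of_mem hk)
        rw [he, pow_one]
        nlinarith
    · intro l hl hlS w hw htl hlR
      by_cases h : l w = t
      · rw [h]; exact hlow w (hlS w hw htl)
      -- The vertices of `l`-level at least `t` lie in `S`, so a vertex of higher `l`-level has
      -- enough neighbours in `S` to survive this round.
      · refine post.dominate l hl ?_ w hw (by omega) (by omega)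
        intro x hx htx
        refine (hmem_keep x).2 ⟨hlS x hx (by omega), (hl x (by omega)).trans ?_⟩
        rw [hdeg]
        exact Nat.cast_le.2 (upDeg_mono fun y hy hly => by
          have : y ∈ S := hlS y (List.ne_nil_of_mem (hsymm x y hy)) (by omega)
          simp [this])
    · exact (le_max_left _ _).trans (hres₁_dens.symm.le.trans post.dens_le)
    · refine post.le_dens.trans (max_le ?_ (le_max_right _ _))
      rw [hres₁_dens]
      exact max_le_max le_rfl hρ_le

end ApprDens

namespace ApprDens

open Timed

/-! ### Counters -/

section Counters

variable {V : Type}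

/-- Loops whose bodies add known numbers to the cells of a table of counters. -/
theorem wp_forEach_add {ι : Type} {l : List ι} {c : V → ℕ → ℕ}
    {f : (V → ℕ → ℕ) → ι → Timed (V → ℕ → ℕ)} {Q : (V → ℕ → ℕ) → ℕ → Prop}
    (h : ι → V → ℕ → ℕ) (b : ι → ℕ)
    (hf : ∀ c i, i ∈ l → wp (f c i) fun c' d => (∀ w t, c' w t = c w t + h i w t) ∧ d = b i)
    (hQ : ∀ c', (∀ w t, c' w t = c w t + (l.map fun i => h i w t).sum) →
      Q c' ((l.map fun i => b i + 1).sum + 1)) : wp (forEach l c f) Q := by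
  refine wp_forEach (fun done c' d => (∀ w t, c' w t = c w t + (done.map fun i => h i w t).sum) ∧
    d = (done.map fun i => b i + 1).sum) (by simp) ?_ ?_
  · rintro done i rest c' d hl ⟨hc', rfl⟩
    refine (hf c' i (by simp [hl])).mono ?_
    rintro c'' d ⟨hc'', rfl⟩
    refine ⟨fun w t => ?_, by simp [add_assoc]⟩
    rw [hc'', hc']
    simp [add_assoc]
  · rintro c' d ⟨hc', rfl⟩
    exact hQ c' hc'

variable [DecidableEq V]

theorem bump_apply (c : V → ℕ → ℕ) (w : V) (t : ℕ) (x : V) (j : ℕ) :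
    bump c w t x j = c x j + if x = w ∧ j = t then 1 else 0 := by
  unfold bump
  by_cases h : x = w
  · subst h
    by_cases h' : j = t
    · subst h'; simp
    · simp [h']
  · simp [h]

theorem sum_indicator {α : Type} [DecidableEq α] {l : List α} (hl : l.Nodup) (p : Prop)
    [Decidable p] (x : α) :
    (l.map fun i => if p ∧ x = i then 1 else 0).sum = if p ∧ x ∈ l then 1 else 0 := by
  induction l with
  | nil => simp
  | cons a l ih =>
    rw [List.nodup_cons] at hl
    rw [List.map_cons, List.sum_cons, ih hl.2]
    by_cases hp : p
    · by_cases hx : x = a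
      · subst hx; simp [hp, hl.1]
      · simp [hp, hx]
    · simp [hp]

theorem sum_indicator_eq_countP {α : Type} (l : List α) (p : α → Prop) [DecidablePred p] :
    (l.map fun i => if p i then 1 else 0).sum = l.countP fun i => decide (p i) := by
  induction l with
  | nil => simp
  | cons a l ih =>
    rw [List.map_cons, List.sum_cons, ih, List.countP_cons]
    by_cases h : p a <;> simp [h, add_comm]

/-- Incrementing the cells `(w, t)` for `t` in a list without repetitions. -/
theorem wp_bump_levels {c : V → ℕ → ℕ} (w : V) {ts : List ℕ} (hts : ts.Nodup)
    {Q : (V → ℕ → ℕ) → ℕ → Prop}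
    (hQ : ∀ c', (∀ x j, c' x j = c x j + if x = w ∧ j ∈ ts then 1 else 0) →
      Q c' (2 * ts.length + 1)) :
    wp (forEach ts c fun c t => step (bump c w t)) Q := by
  refine wp_forEach_add (fun t x j => if x = w ∧ j = t then 1 else 0) (fun _ => 1)
    (fun c t _ => by simp [bump_apply]) fun c' hc' => ?_
  have := hQ c' fun x j => by rw [hc', sum_indicator hts]
  simpa [mul_comm] using this

theorem foldl_reset (ts : List ℕ) (c : V → ℕ → ℕ) (v x : V) (j : ℕ) :
    ts.foldl (fun c t => Function.update c v (Function.update (c v) t 0)) c x j =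
      if x = v ∧ j ∈ ts then 0 else c x j := by
  induction ts generalizing c with
  | nil => simp
  | cons t ts ih =>
    rw [List.foldl_cons, ih]
    by_cases hx : x = v
    · subst hx
      by_cases hj : j = t
      · subst hj; simp
      · simp [hj]
    · simp [hx]

theorem foldl_foldl_reset (ts : List ℕ) (vs : List V) (c : V → ℕ → ℕ) (x : V) (j : ℕ) :
    vs.foldl (fun c v => ts.foldl
      (fun c t => Function.update c v (Function.update (c v) t 0)) c) c x j =
      if x ∈ vs ∧ j ∈ ts then 0 else c x j := by
  induction vs generalizing c with
  | nil => simp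
  | cons v vs ih =>
    rw [List.foldl_cons, ih, foldl_reset]
    by_cases hj : j ∈ ts
    · by_cases hx : x = v <;> simp [hj, hx]
    · simp [hj]

end Counters

/-! ### Invariants -/

variable {V : Type}

/-- The lists and tables of the state describe one and the same graph. -/
structure GraphOK (D : DensState V) : Prop where
  adj_nodup : ∀ v, (D.adj v).Nodup
  adj_symm : ∀ v w, w ∈ D.adj v → v ∈ D.adj w
  hasEdge_iff : ∀ v w, D.hasEdge v w = true ↔ w ∈ D.adj v
  verts_nodup : D.verts.Nodup
  mem_verts : ∀ v, v ∈ D.verts ↔ D.adj v ≠ []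

/-- The bounds on the density guess and on the recorded density. -/
structure GuessOK (ε : ℝ) (D : DensState V) : Prop where
  β_ge : 1 / (4 * (1 + ε)) ≤ D.β
  dens_nonneg : 0 ≤ D.dens
  dens_le : D.dens ≤ D.β

/-- The levels are below `L`, and vertices of a level `t > 0` have sufficiently many neighbours of
level at least `t - 1`. -/
structure LevelsOK (ε : ℝ) (L : ℕ) (D : DensState V) : Prop where
  lvl_lt : ∀ v, D.lvl v < L
  le_upDeg : ∀ v, 0 < D.lvl v →
    2 * (1 + ε) * D.β ≤ (upDeg D.adj D.lvl v (D.lvl v - 1) : ℝ)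

/-- The counters are correct. -/
def CountersOK (D : DensState V) : Prop := ∀ v t, D.cnt v t = upDeg D.adj D.lvl v t

/-- The invariant of the incremental densest-subgraph algorithm between two insertions. -/
structure Valid (ε : ℝ) (L : ℕ) (D : DensState V) : Prop where
  graph : GraphOK D
  guess : GuessOK ε D
  levels : LevelsOK ε L D
  counters : CountersOK D

/-- Both states store the same graph. -/
structure SameGraph (D D' : DensState V) : Prop where
  verts : D'.verts = D.verts
  adj : D'.adj = D.adj
  hasEdge : D'.hasEdge = D.hasEdge

theorem SameGraph.graphOK {D D' : DensState V} (h : SameGraph D D') (hD : GraphOK D) :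
    GraphOK D' := by
  obtain ⟨h1, h2, h3⟩ := h
  constructor
  · rw [h2]; exact hD.adj_nodup
  · rw [h2]; exact hD.adj_symm
  · rw [h2, h3]; exact hD.hasEdge_iff
  · rw [h1]; exact hD.verts_nodup
  · rw [h1, h2]; exact hD.mem_verts

theorem GuessOK.β_pos {ε : ℝ} (hε : 0 < ε) {D : DensState V} (h : GuessOK ε D) : 0 < D.β :=
  lt_of_lt_of_le (by positivity) h.β_ge

/-- A positive level requires neighbours. Peeling leaves the levels of isolated vertices untouched,
so they must already be 0. -/
theorem LevelsOK.lvl_eq_zero {ε : ℝ} (hε : 0 < ε) {L : ℕ} {D : DensState V}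
    (h : LevelsOK ε L D) (hg : GuessOK ε D) {v : V} (hv : D.adj v = []) : D.lvl v = 0 := by
  by_contra h0
  have h1 := h.le_upDeg v (Nat.pos_of_ne_zero h0)
  have h2 := hg.β_pos hε
  simp only [upDeg, hv, List.countP_nil, Nat.cast_zero] at h1
  have : 0 < 2 * (1 + ε) * D.β := by positivity
  linarith

/-! ### The number of increases of the density guess -/

/-- A bound for the number of times that the guess `β` can still grow by a factor `1 + ε`, on
graphs with `n` vertices. -/
noncomputable def gap (ε : ℝ) (n : ℕ) (β : ℝ) : ℕ :=
  sInf {j : ℕ | (1 + ε) * n / 2 ≤ (1 + ε) ^ j * β}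

theorem gap_mem {ε : ℝ} (hε : 0 < ε) (n : ℕ) {β : ℝ} (hβ : 0 < β) :
    (1 + ε) * n / 2 ≤ (1 + ε) ^ gap ε n β * β := by
  refine Nat.sInf_mem (s := {j : ℕ | (1 + ε) * n / 2 ≤ (1 + ε) ^ j * β}) ?_
  obtain ⟨j, hj⟩ := pow_unbounded_of_one_lt ((1 + ε) * n / 2 / β) (by linarith : 1 < 1 + ε)
  exact ⟨j, ((div_lt_iff₀ hβ).1 hj).le⟩

/-- One factor 1 + ε moves from the power into β. The gap before the increase cannot be 0, since β'
is still at most the cap (1+ε)n/2. -/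
theorem gap_add_one_le {ε : ℝ} (hε : 0 < ε) {n : ℕ} {β β' : ℝ} (hβ : 0 < β)
    (h : (1 + ε) * β ≤ β') (hβ' : β' ≤ (1 + ε) * n / 2) : gap ε n β' + 1 ≤ gap ε n β := by
  have hm := gap_mem hε n hβ
  rcases hg : gap ε n β with _ | j
  · rw [hg] at hm
    simp only [pow_zero, one_mul] at hm
    nlinarith
  · rw [hg, pow_succ] at hm
    refine Nat.succ_le_succ (Nat.sInf_le ?_)
    have : 0 < (1 + ε) ^ j := by positivity
    show (1 + ε) * n / 2 ≤ (1 + ε) ^ j * β'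
    nlinarith

theorem gap_le {ε : ℝ} (hε : 0 < ε) {n L : ℕ} (hL : 1 ≤ L) (hn : 2 ≤ n)
    (hnL : (n : ℝ) ≤ (1 + ε) ^ L) {β : ℝ} (hβ : 1 / (4 * (1 + ε)) ≤ β) :
    gap ε n β ≤ 4 * L := by
  -- Two factors (1+ε)^L supply n² ≥ 2n, and the two extra factors cancel the denominator 1 + ε of
  -- the initial guess and supply that of the cap.
  refine (Nat.sInf_le (m := 2 * L + 2) ?_).trans (by omega)
  show (1 + ε) * n / 2 ≤ (1 + ε) ^ (2 * L + 2) * β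
  have hn' : (2 : ℝ) ≤ n := by exact_mod_cast hn
  have h1 : (1 + ε) ^ (2 * L + 2) * (1 / (4 * (1 + ε))) ≤ (1 + ε) ^ (2 * L + 2) * β :=
    mul_le_mul_of_nonneg_left hβ (by positivity)
  have h2 : (1 + ε) ^ (2 * L + 2) * (1 / (4 * (1 + ε))) =
      (1 + ε) * ((1 + ε) ^ L * (1 + ε) ^ L) / 4 := by
    field_simp
    ring
  have h3 : (n : ℝ) * 2 ≤ (1 + ε) ^ L * (1 + ε) ^ L := by nlinarith
  have h4 : (1 + ε) * (n * 2) ≤ (1 + ε) * ((1 + ε) ^ L * (1 + ε) ^ L) :=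
    mul_le_mul_of_nonneg_left h3 (by linarith)
  linarith

section

variable [DecidableEq V]

/-- A rebuild fills the counters of `w` from the side of its neighbours; symmetry of adjacency makes
this the count from the side of `w`. -/
theorem countP_verts {D : DensState V} (hD : GraphOK D) (w : V) (t : ℕ) :
    (D.verts.countP fun v => decide (t ≤ D.lvl v ∧ w ∈ D.adj v)) = upDeg D.adj D.lvl w t := by
  have hperm : (D.verts.filter fun v => decide (w ∈ D.adj v)).Perm (D.adj w) := by
    refine (List.perm_ext_iff_of_nodup (hD.verts_nodup.filter _) (hD.adj_nodup w)).2 fun v => ?_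
    simp only [List.mem_filter, decide_eq_true_eq]
    constructor
    · exact fun h => hD.adj_symm _ _ h.2
    · intro h
      have h' := hD.adj_symm _ _ h
      exact ⟨(hD.mem_verts v).2 (List.ne_nil_of_mem h'), h'⟩
  rw [upDeg, ← hperm.countP_eq, List.countP_filter]
  simp

end

variable [Fintype V]

/-! ### Rebuilding -/

/-- The potential that pays for lifting vertices. -/
def liftPotential (L : ℕ) (D : DensState V) : ℕ := ∑ v, (D.adj v).length * (L - D.lvl v)

/-- The potential that pays for lifting vertices and for rebuilding. -/
noncomputable def potential (ε : ℝ) (L : ℕ) (D : DensState V) : ℕ :=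
  20 * liftPotential L D + 100 * (vol D.adj * L) * gap ε (Fintype.card V) D.β

theorem liftPotential_le (L : ℕ) (D : DensState V) : liftPotential L D ≤ vol D.adj * L := by
  rw [vol, Finset.sum_mul]
  exact Finset.sum_le_sum fun v _ => Nat.mul_le_mul_left _ (Nat.sub_le _ _)

/-- A rebuild is justified by a family of levels with sufficiently many neighbours in which some
vertex has level `L`. -/
def Overflow (ε : ℝ) (L : ℕ) (D : DensState V) : Prop :=
  ∃ l : V → ℕ, (∀ v, 0 < l v → 2 * (1 + ε) * D.β ≤ (upDeg D.adj l v (l v - 1) : ℝ)) ∧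
    ∃ s, D.adj s ≠ [] ∧ l s = L

/-- A failed peeling shrinks geometrically, so every level `j > 0` satisfies (1+ε)^j < n ≤ (1+ε)^L.
By `dominate`, no compatible family can then reach level `L`. -/
theorem levels_of_find_lt {ε : ℝ} (hε : 0 < ε) {L : ℕ} (hL : 1 ≤ L)
    (hnL : (Fintype.card V : ℝ) ≤ (1 + ε) ^ L) {D : DensState V} (hD : GraphOK D)
    (hlvl : ∀ w, D.adj w = [] → D.lvl w = 0) {res : FindResult V}
    (post : FindPost D.adj ε D.β (L + 1) 0 D.verts { lvl := D.lvl, sol := [], dens := 0 } res)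
    (hfail : res.dens < D.β) : LevelsOK ε L { D with lvl := res.lvl } ∧ ¬Overflow ε L D := by
  have hzero : ∀ w, D.adj w = [] → res.lvl w = 0 := fun w hw => by
    rw [post.not_mem w fun h => (hD.mem_verts w).1 h hw]
    exact hlvl w hw
  have hlt : ∀ v, res.lvl v < L := by
    intro v
    rcases Nat.eq_zero_or_pos (res.lvl v) with h0 | h0
    · omega
    · have hv : D.adj v ≠ [] := fun h => by have := hzero v h; omega
      have h1 := post.shrink hfail v ((hD.mem_verts v).2 hv) h0
      have h2 : (D.verts.length : ℝ) ≤ Fintype.card V := by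
        exact_mod_cast hD.verts_nodup.length_le_card
      rw [Nat.sub_zero] at h1
      exact (pow_lt_pow_iff_right₀ (by linarith : 1 < 1 + ε)).1 (by linarith)
  refine ⟨⟨hlt, ?_⟩, ?_⟩
  · intro v h0
    have hv : D.adj v ≠ [] := fun h => by
      have := hzero v h
      simp only at h0
      omega
    exact post.deg v ((hD.mem_verts v).2 hv) h0
  · rintro ⟨l, hl, s, hs, hsL⟩
    have := post.dominate l hl (fun w hw _ => (hD.mem_verts w).2 hw) s hs (Nat.zero_le _)
      (by omega)
    have := hlt s
    omega

variable [DecidableEq V]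

theorem wp_find {ε : ℝ} (hε : 0 < ε) (L : ℕ) {D : DensState V} (hD : GraphOK D)
    (hg : GuessOK ε D) :
    wp (find ε L D D.β) fun res c => c ≤ 12 * vol D.adj * (L + 1) + 3 ∧
      FindPost D.adj ε D.β (L + 1) 0 D.verts { lvl := D.lvl, sol := [], dens := 0 } res := by
  unfold find
  simp only [wp_bind, wp_step]
  refine (wp_findRounds hε (hg.β_pos hε) hD.adj_symm hD.adj_nodup (L + 1) 0 D.verts
    { lvl := D.lvl, sol := [], dens := 0 } hD.verts_nodup (fun v hv => (hD.mem_verts v).1 hv)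
    (fun w hw => Or.inl ⟨(hD.mem_verts w).2 hw, Nat.succ_pos L⟩) (by simp)).mono ?_
  rintro res c ⟨hc, post⟩
  exact ⟨by omega, post⟩

/-- Each successful peeling lowers the gap and so pays for itself; the final failed one costs one
extra unit. The overflow hypothesis guarantees at least one success. -/
theorem wp_findDensest {ε : ℝ} (hε : 0 < ε) {L : ℕ} (hL : 1 ≤ L)
    (hnL : (Fintype.card V : ℝ) ≤ (1 + ε) ^ L) {D₀ : DensState V} (hD₀ : GraphOK D₀)
    (hg₀ : GuessOK ε D₀) (hlvl : ∀ w, D₀.adj w = [] → D₀.lvl w = 0) (hover : Overflow ε L D₀) :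
    wp (findDensest ε L D₀) fun D c => SameGraph D₀ D ∧ D.cnt = D₀.cnt ∧ GuessOK ε D ∧
      LevelsOK ε L D ∧ D₀.dens ≤ D.dens ∧
      gap ε (Fintype.card V) D.β + 1 ≤ gap ε (Fintype.card V) D₀.β ∧
      c + (12 * vol D₀.adj * (L + 1) + 5) * gap ε (Fintype.card V) D.β ≤
        (12 * vol D₀.adj * (L + 1) + 5) * (gap ε (Fintype.card V) D₀.β + 1) := by
  unfold findDensest
  set F := 12 * vol D₀.adj * (L + 1) + 5 with hF
  set g := gap ε (Fintype.card V) with hgap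
  -- The last disjunction remembers whether a success has occurred.
  refine wp_loop (fun D c => (SameGraph D₀ D ∧ D.cnt = D₀.cnt ∧ D.lvl = D₀.lvl) ∧ GuessOK ε D ∧
    D₀.dens ≤ D.dens ∧ c + F * g D.β ≤ F * g D₀.β ∧ (D = D₀ ∨ g D.β + 1 ≤ g D₀.β))
    (fun D => g D.β) ⟨⟨⟨rfl, rfl, rfl⟩, rfl, rfl⟩, hg₀, le_rfl, by omega, Or.inl rfl⟩ ?_
  rintro D c ⟨⟨hsame, hcnt, hl⟩, hg, hdens, hc, hD⟩
  have hDok := hsame.graphOK hD₀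
  simp only [wp_bind, wp_step]
  refine (wp_find hε L hDok hg).mono ?_
  rintro res d ⟨hd, post⟩
  rw [hsame.adj] at hd
  have hβ := hg.β_pos hε
  refine wp_ite _ _ _ _ (fun h => ?_) (fun h => ?_)
  · simp only [decide_eq_true_eq] at h
    have hmax := post.le_dens
    have hdle : res.dens ≤ (Fintype.card V : ℝ) / 2 := by
      rwa [max_eq_right (by positivity)] at hmax
    have hstep : g ((1 + ε) * res.dens) + 1 ≤ g D.β :=
      gap_add_one_le hε hβ (by nlinarith) (by nlinarith)
    have hmul : F * (g ((1 + ε) * res.dens) + 1) ≤ F * g D.β := Nat.mul_le_mul_left _ hstep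
    rw [mul_add] at hmul
    have hle : g D.β ≤ g D₀.β := by rcases hD with rfl | hD <;> omega
    simp only [wp_step, Sum.elim_inr]
    refine ⟨⟨⟨⟨hsame.verts, hsame.adj, hsame.hasEdge⟩, hcnt, hl⟩, ⟨?_, by simp; linarith, ?_⟩, ?_, ?_,
      Or.inr (by omega)⟩, by omega⟩
    · have := hg.β_ge
      simp only
      nlinarith
    · simp only
      nlinarith
    · have := hg.dens_le
      linarith
    · omega
  · simp only [decide_eq_true_eq, not_le] at h
    obtain ⟨hlev, hno⟩ := levels_of_find_lt hε hL hnL hDok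
      (by rw [hsame.adj, hl]; exact hlvl) post h
    have hlt : g D.β + 1 ≤ g D₀.β := by
      rcases hD with rfl | hD
      -- Failure of the very first peeling contradicts the overflow.
      · exact absurd hover hno
      · exact hD
    simp only [wp_step, Sum.elim_inl]
    refine ⟨⟨hsame.verts, hsame.adj, hsame.hasEdge⟩, hcnt, ⟨hg.β_ge, hg.dens_nonneg, hg.dens_le⟩,
      hlev, hdens, hlt, ?_⟩
    rw [mul_add]
    omega

/-- The drop of the gap pays for the peelings, for resetting and recounting the counters, and for
the lift potential, which may go back up to its maximum `vol · L`. -/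
theorem wp_rebuild {ε : ℝ} (hε : 0 < ε) {L : ℕ} (hL : 1 ≤ L)
    (hnL : (Fintype.card V : ℝ) ≤ (1 + ε) ^ L) {D₀ : DensState V} (hD₀ : Valid ε L D₀)
    (hover : Overflow ε L D₀) :
    wp (rebuild ε L D₀) fun D c => Valid ε L D ∧ D₀.dens ≤ D.dens ∧
      c + potential ε L D ≤ potential ε L D₀ := by
  unfold rebuild
  simp only [wp_bind]
  refine (wp_findDensest hε hL hnL hD₀.graph hD₀.guess
    (fun w hw => hD₀.levels.lvl_eq_zero hε hD₀.guess hw) hover).mono ?_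
  rintro D c ⟨hsame, hcnt, hg, hlev, hdens, hgap, hc⟩
  have hDok := hsame.graphOK hD₀.graph
  refine wp_forEach_foldl (fun c v => (List.range (L + 1)).foldl
    (fun c t => Function.update c v (Function.update (c v) t 0)) c) (fun _ => 2 * L + 3) ?_ ?_
  · intro c v _
    refine wp_forEach_foldl _ (fun _ => 1) (fun c t _ => by simp) ⟨rfl, ?_⟩
    simp
    ring
  set zeroed := D.verts.foldl (fun c v => (List.range (L + 1)).foldl
    (fun c t => Function.update c v (Function.update (c v) t 0)) c) D.cnt with hz
  have hzero : ∀ w t, zeroed w t = 0 := by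
    intro w t
    rw [hz, foldl_foldl_reset]
    split_ifs with h
    · rfl
    -- Cells that are not reset are already 0: either `t` exceeds all old levels, or the vertex is
    -- isolated.
    · rw [hcnt, hD₀.counters]
      by_cases hw : w ∈ D.verts
      · have ht : L + 1 ≤ t := by simpa [hw] using h
        refine List.countP_eq_zero.2 fun x _ => ?_
        have := hD₀.levels.lvl_lt x
        simp
        omega
      · rw [hDok.mem_verts, hsame.adj, not_not] at hw
        simp [upDeg, hw]
  refine wp_forEach_add (fun v w t => if t ≤ D.lvl v ∧ w ∈ D.adj v then 1 else 0)
    (fun v => (D.adj v).length * (2 * D.lvl v + 4) + 1) ?_ ?_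
  · intro c v _
    refine wp_forEach_add (fun w x t => if t ≤ D.lvl v ∧ x = w then 1 else 0)
      (fun _ => 2 * D.lvl v + 3) ?_ ?_
    · intro c w _
      refine wp_bump_levels w List.nodup_range fun c' hc' => ⟨fun x t => ?_, by simp; ring⟩
      rw [hc']
      simp [and_comm]
    · intro c' hc'
      refine ⟨fun x t => ?_, by simp⟩
      rw [hc', sum_indicator (hDok.adj_nodup v)]
  intro c' hc'
  simp only [wp_step]
  refine ⟨⟨⟨hDok.adj_nodup, hDok.adj_symm, hDok.hasEdge_iff, hDok.verts_nodup, hDok.mem_verts⟩,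
    ⟨hg.β_ge, hg.dens_nonneg, hg.dens_le⟩, ⟨hlev.lvl_lt, hlev.le_upDeg⟩, ?_⟩, hdens, ?_⟩
  · intro w t
    simp only
    rw [hc', hzero, zero_add, ← countP_verts hDok]
    exact sum_indicator_eq_countP D.verts fun v => t ≤ D.lvl v ∧ w ∈ D.adj v
  · have hpot := liftPotential_le L D
    obtain ⟨l, hl, s, hs, -⟩ := hover
    have hlen : D.verts.length ≤ vol D.adj :=
      length_le_vol hDok.verts_nodup fun v hv => (hDok.mem_verts v).1 hv
    have hvol : 1 ≤ vol D.adj := by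
      rw [← hsame.adj] at hs
      exact le_trans (List.length_pos_iff.2 (List.ne_nil_of_mem ((hDok.mem_verts s).2 hs))) hlen
    have hsum := sum_map_le_sum_univ hDok.verts_nodup fun v => (D.adj v).length
    rw [← vol] at hsum
    have h1 : (D.verts.map fun v => (D.adj v).length * (2 * D.lvl v + 4) + 1 + 1).sum ≤
        (D.verts.map fun v => (D.adj v).length).sum * (2 * L + 4) + 2 * D.verts.length := by
      generalize D.verts = S
      induction S with
      | nil => simp
      | cons x S ih =>
        simp only [List.map_cons, List.sum_cons, List.length_cons]
        have := hlev.lvl_lt x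
        have : (D.adj x).length * (2 * D.lvl x + 4) ≤ (D.adj x).length * (2 * L + 4) := by gcongr
        rw [add_mul]
        omega
    have hpot' : potential ε L { D with cnt := c' } = potential ε L D := rfl
    rw [hpot']
    unfold potential
    rw [hsame.adj] at h1 hlen hvol hsum hpot ⊢
    simp only [List.map_const', List.sum_replicate, smul_eq_mul]
    generalize hgD : gap ε (Fintype.card V) D.β = gD at *
    generalize hgD₀ : gap ε (Fintype.card V) D₀.β = g₀ at *
    generalize vol D₀.adj = W at *
    generalize liftPotential L D = P at *
    -- The gap drops by `j + 1`, which bounds the number of peelings by `j + 2`.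
    obtain ⟨j, rfl⟩ := Nat.exists_eq_add_of_le hgap
    have hWL : W ≤ W * L := Nat.le_mul_of_pos_right _ hL
    have hWL' : L ≤ W * L := Nat.le_mul_of_pos_left _ hvol
    have h2 := Nat.mul_le_mul_right (2 * L + 4) hsum
    have h3 := Nat.mul_le_mul_right (2 * L + 4) hlen
    generalize hX : W * L = X at *
    have e1 : W * (2 * L + 4) = 2 * X + 4 * W := by rw [← hX]; ring
    have e2 : 12 * W * (L + 1) + 5 = 12 * X + 12 * W + 5 := by rw [← hX]; ring
    have hF : 12 * X + 12 * W + 5 ≤ 29 * X := by omega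
    rw [e1] at h2 h3
    rw [e2] at hc
    have e3 : (12 * X + 12 * W + 5) * (gD + 1 + j + 1) =
      (12 * X + 12 * W + 5) * gD + (12 * X + 12 * W + 5) * (j + 2) := by ring
    have e4 : 100 * X * (gD + 1 + j) = 100 * X * gD + 100 * X + 100 * (X * j) := by ring
    have h5 : (12 * X + 12 * W + 5) * (j + 2) ≤ 29 * X * (j + 2) := Nat.mul_le_mul_right _ hF
    have e5 : 29 * X * (j + 2) = 29 * (X * j) + 58 * X := by ring
    have e6 : D.verts.length * (2 * L + 3 + 1) = D.verts.length * (2 * L + 4) := by ring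
    rw [e6]
    omega

end ApprDens

namespace ApprDens

open Timed

/-! ### Lifting vertices -/

theorem wp_nextLevel (c : ℕ → ℕ) (thr : ℝ) (R t : ℕ) :
    wp (nextLevel c thr R t) fun t' d => t ≤ t' ∧ t' ≤ t + R ∧ d ≤ t' - t + 1 ∧
      ∀ j, t ≤ j → j < t' → thr ≤ (c j : ℝ) := by
  induction R generalizing t with
  | zero =>
    simp only [nextLevel, wp_step]
    exact ⟨le_rfl, le_rfl, by omega, fun j _ _ => by omega⟩
  | succ R ih =>
    simp only [nextLevel, wp_bind, wp_step]
    refine wp_ite _ _ _ _ (fun h => ?_) (fun h => ?_)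
    · simp only [wp_pure]
      exact ⟨le_rfl, by omega, by omega, fun j _ _ => by omega⟩
    · refine (ih (t + 1)).mono ?_
      rintro t' d ⟨h1, h2, h3, h4⟩
      refine ⟨by omega, by omega, by omega, fun j hj hjt => ?_⟩
      rcases Nat.eq_or_lt_of_le hj with rfl | hj
      · simpa using h
      · exact h4 j hj hjt

variable {V : Type}

theorem wp_init [Fintype V] {ε : ℝ} (hε : 0 < ε) {L : ℕ} (hL : 1 ≤ L) :
    wp (init (V := V) ε) fun D c => Valid ε L D ∧ D.dens = 0 ∧ potential ε L D = 0 ∧ c = 1 := by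
  unfold init
  simp only [wp_step]
  refine ⟨⟨⟨by simp, by simp, by simp, by simp, by simp⟩, ⟨le_rfl, le_rfl, ?_⟩,
    ⟨fun _ => hL, by simp⟩, fun v t => by simp [upDeg]⟩, trivial, ?_, trivial⟩
  · simp only
    positivity
  · simp [potential, liftPotential, vol]

variable [DecidableEq V]

theorem upDeg_update {adj : V → List V} {lvl : V → ℕ} {s w : V} {t' : ℕ}
    (hw : (adj w).Nodup) (ht : lvl s ≤ t') (j : ℕ) :
    upDeg adj (Function.update lvl s t') w j =
      upDeg adj lvl w j + if s ∈ adj w ∧ lvl s < j ∧ j ≤ t' then 1 else 0 := by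
  unfold upDeg
  generalize adj w = l at hw
  induction l with
  | nil => simp
  | cons x l ih =>
    rw [List.nodup_cons] at hw
    rw [List.countP_cons, List.countP_cons, ih hw.2]
    by_cases hx : x = s
    · subst hx
      simp only [Function.update_self, List.mem_cons, true_or, true_and, decide_eq_true_eq, hw.1,
        false_and, if_false]
      split_ifs <;> omega
    · have hx' : s ≠ x := fun h => hx h.symm
      simp only [Function.update_of_ne hx, List.mem_cons, hx', false_or]
      omega

/-- Lifting a vertex can only add neighbours in the sets seen by the others, so only the lifted
vertex needs checking. -/
theorem le_upDeg_update {adj : V → List V} {lvl : V → ℕ} {s : V} {t' : ℕ} {thr : ℝ}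
    (ht : lvl s ≤ t')
    (h : ∀ v, 0 < lvl v → thr ≤ (upDeg adj lvl v (lvl v - 1) : ℝ))
    (hs : thr ≤ (upDeg adj lvl s (t' - 1) : ℝ)) (v : V)
    (hv : 0 < Function.update lvl s t' v) :
    thr ≤ (upDeg adj (Function.update lvl s t') v (Function.update lvl s t' v - 1) : ℝ) := by
  have hmono : ∀ v j, upDeg adj lvl v j ≤ upDeg adj (Function.update lvl s t') v j := by
    refine fun v j => upDeg_mono fun w _ hw => ?_
    by_cases h : w = s
    · subst h; simp; omega
    · simpa [h] using hw
  refine le_trans ?_ (Nat.cast_le.2 (hmono _ _))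
  by_cases hvs : v = s
  · subst hvs; simpa using hs
  · simp only [Function.update_of_ne hvs] at hv ⊢
    exact h v hv

theorem CountersOK.lift {D : DensState V} (hD : CountersOK D) (hg : GraphOK D) {s : V} {t' : ℕ}
    (ht : D.lvl s ≤ t') {cnt : V → ℕ → ℕ} (hcnt : ∀ w j, cnt w j =
      D.cnt w j + if (D.lvl s < j ∧ j ≤ t') ∧ w ∈ D.adj s then 1 else 0) :
    CountersOK { D with lvl := Function.update D.lvl s t', cnt := cnt } := by
  intro w j
  simp only
  rw [hcnt, hD, upDeg_update (hg.adj_nodup w) ht]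
  have : w ∈ D.adj s ↔ s ∈ D.adj w := ⟨hg.adj_symm _ _, hg.adj_symm _ _⟩
  simp only [this, and_comm]

/-- The witness is the current family of levels with `s` hypothetically lifted to `L`. -/
theorem Valid.overflow {ε : ℝ} (hε : 0 < ε) {L : ℕ} {D : DensState V} (hD : Valid ε L D) {s : V}
    (h : 2 * (1 + ε) * D.β ≤ (D.cnt s (L - 1) : ℝ)) : Overflow ε L D := by
  rw [hD.counters] at h
  refine ⟨Function.update D.lvl s L,
    le_upDeg_update (hD.levels.lvl_lt s).le hD.levels.le_upDeg h, s, ?_, by simp⟩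
  intro hs
  have := hD.guess.β_pos hε
  have : 0 < 2 * (1 + ε) * D.β := by positivity
  simp only [upDeg, hs, List.countP_nil, Nat.cast_zero] at h
  linarith

variable [Fintype V]

theorem liftPotential_lift {L : ℕ} (D : DensState V) {s : V} {t' : ℕ} (h : D.lvl s ≤ t')
    (hL : t' ≤ L) (cnt : V → ℕ → ℕ) :
    liftPotential L { D with lvl := Function.update D.lvl s t', cnt := cnt } +
      (D.adj s).length * (t' - D.lvl s) = liftPotential L D := by
  unfold liftPotential
  rw [← Finset.add_sum_erase _ _ (Finset.mem_univ s),
    ← Finset.add_sum_erase _ (fun v => (D.adj v).length * (L - D.lvl v)) (Finset.mem_univ s)]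
  have : ∑ x ∈ Finset.univ.erase s, (D.adj x).length * (L - Function.update D.lvl s t' x) =
      ∑ x ∈ Finset.univ.erase s, (D.adj x).length * (L - D.lvl x) :=
    Finset.sum_congr rfl fun x hx => by rw [Function.update_of_ne (Finset.ne_of_mem_erase hx)]
  simp only [this, Function.update_self]
  have e : L - D.lvl s = (L - t') + (t' - D.lvl s) := by omega
  rw [e, mul_add]
  omega

/-- Every stack entry carries 5 units to pay for its check. A lift by Δ releases 20 · deg · Δ units,
enough for the counter updates, the level search and the 5 units of each pushed neighbour. The same
quantity is the termination measure. The additive `L` pays for a search that ends in an overflow. -/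
theorem wp_propagate {ε : ℝ} (hε : 0 < ε) {L : ℕ} {D₀ : DensState V} (hD₀ : Valid ε L D₀)
    (stack₀ : List V) :
    wp (propagate ε L D₀ stack₀) fun r c => Valid ε L r.2 ∧ r.2.adj = D₀.adj ∧ r.2.β = D₀.β ∧
      r.2.dens = D₀.dens ∧ (r.1 = true → Overflow ε L r.2) ∧
      c + 20 * liftPotential L r.2 ≤
        5 * stack₀.length + 20 * liftPotential L D₀ + L + 6 := by
  unfold propagate
  refine wp_loop (fun p c => Valid ε L p.2 ∧ p.2.adj = D₀.adj ∧ p.2.β = D₀.β ∧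
      p.2.dens = D₀.dens ∧ c + 5 * p.1.length + 20 * liftPotential L p.2 ≤
        5 * stack₀.length + 20 * liftPotential L D₀)
    (fun p => 5 * p.1.length + 20 * liftPotential L p.2)
    ⟨hD₀, rfl, rfl, rfl, by simp⟩ ?_
  rintro ⟨_ | ⟨s, stack⟩, D⟩ c ⟨hD, hadj, hβ, hdens, hc⟩
  · simp only [wp_step, Sum.elim_inl]
    exact ⟨hD, hadj, hβ, hdens, by simp, by simp only [List.length_nil] at hc; omega⟩
  simp only [List.length_cons] at hc
  simp only [wp_bind, wp_step]
  replace hD : Valid ε L D := hD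
  have hlt := hD.levels.lvl_lt s
  refine wp_ite _ _ _ _ (fun h => ?_) (fun h => ?_)
  · simp only [wp_step, Sum.elim_inr]
    exact ⟨⟨hD, hadj, hβ, hdens, by omega⟩, by simp⟩
  have hs : 2 * (1 + ε) * D.β ≤ (D.cnt s (D.lvl s) : ℝ) := by simpa using h
  simp only [wp_bind, wp_step]
  refine (wp_nextLevel _ _ _ _).mono ?_
  rintro t' d ⟨h1, h2, h3, h4⟩
  -- If the search stops at once, `t' - 1` is the old level, where the violation itself gives the
  -- bound.
  have hs' : 2 * (1 + ε) * D.β ≤ (D.cnt s (t' - 1) : ℝ) := by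
    rcases Nat.eq_or_lt_of_le h1 with h5 | h5
    · rw [← h5]; exact hs
    · exact h4 _ (by omega) (by omega)
  refine wp_ite _ _ _ _ (fun ht => ?_) (fun ht => ?_)
  · simp only [decide_eq_true_eq] at ht
    simp only [wp_step, Sum.elim_inl]
    have : t' = L := by omega
    subst this
    refine ⟨hD, hadj, hβ, hdens, fun _ => hD.overflow hε hs', ?_⟩
    omega
  simp only [decide_eq_true_eq, not_le] at ht
  simp only [wp_bind, wp_step]
  refine wp_forEach (fun done q e => q.1.length = stack.length + done.length ∧
      (∀ w j, q.2 w j = D.cnt w j +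
        (done.map fun x => if (D.lvl s < j ∧ j ≤ t') ∧ w = x then 1 else 0).sum) ∧
      e = done.length * (2 * (t' - D.lvl s) + 3)) (by simp) ?_ ?_
  · rintro done w rest ⟨st, cn⟩ e hl ⟨hst, hcn, rfl⟩
    simp only at hst hcn
    simp only [wp_bind]
    refine wp_bump_levels w List.nodup_range' fun c' hc' => ?_
    simp only [wp_step, List.length_cons, List.length_append, List.length_nil,
      List.length_range']
    refine ⟨by omega, fun x j => ?_, by ring⟩
    rw [hc', hcn, List.map_append, List.sum_append]
    have hiff : j ∈ List.range' (D.lvl s + 1) (t' - D.lvl s) ↔ D.lvl s < j ∧ j ≤ t' := by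
      rw [List.mem_range'_1]; omega
    simp only [hiff, List.map_cons, List.map_nil, List.sum_cons, List.sum_nil, add_zero, add_assoc,
      and_comm]
  rintro ⟨st, cn⟩ e ⟨hst, hcn, rfl⟩
  simp only at hst hcn
  simp only [Sum.elim_inr]
  have hcn' : ∀ w j, cn w j =
      D.cnt w j + if (D.lvl s < j ∧ j ≤ t') ∧ w ∈ D.adj s then 1 else 0 := fun w j => by
    rw [hcn, sum_indicator (hD.graph.adj_nodup s)]
  have hlvl : D.lvl s ≤ t' := by omega
  have hpot := liftPotential_lift D hlvl ht.le cn
  -- Without this the released potential could be 0; a violating vertex reaches a positive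
  -- threshold, so it has a neighbour.
  have hlen : 1 ≤ (D.adj s).length := by
    refine List.length_pos_iff.2 fun hnil => ?_
    rw [hD.counters] at hs
    have := hD.guess.β_pos hε
    have : 0 < 2 * (1 + ε) * D.β := by positivity
    simp only [upDeg, hnil, List.countP_nil, Nat.cast_zero] at hs
    linarith
  generalize hP : liftPotential L
    { D with lvl := Function.update D.lvl s t', cnt := cn } = P at hpot ⊢
  have hmul : (D.adj s).length * 1 ≤ (D.adj s).length * (t' - D.lvl s) :=
    Nat.mul_le_mul_left _ (by omega)
  have hmul' : 1 * (t' - D.lvl s) ≤ (D.adj s).length * (t' - D.lvl s) :=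
    Nat.mul_le_mul_right _ hlen
  have hexp : (D.adj s).length * (2 * (t' - D.lvl s) + 3) =
    2 * ((D.adj s).length * (t' - D.lvl s)) + 3 * (D.adj s).length := by ring
  rw [hexp]
  refine ⟨⟨⟨⟨hD.graph.adj_nodup, hD.graph.adj_symm, hD.graph.hasEdge_iff, hD.graph.verts_nodup,
    hD.graph.mem_verts⟩, ⟨hD.guess.β_ge, hD.guess.dens_nonneg, hD.guess.dens_le⟩, ⟨?_, ?_⟩,
    hD.counters.lift hD.graph hlvl hcn'⟩, hadj, hβ, hdens, ?_⟩, ?_⟩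
  · intro v
    simp only
    by_cases hv : v = s
    · subst hv; simpa using ht
    · simpa [hv] using hD.levels.lvl_lt v
  · rw [hD.counters] at hs'
    exact le_upDeg_update hlvl hD.levels.le_upDeg hs'
  · omega
  · simp only [List.length_cons]
    omega

/-! ### Insertion of edges -/

theorem wp_link {ε : ℝ} {L : ℕ} {D : DensState V} (hD : Valid ε L D) {u v : V} (huv : u ≠ v)
    (hnew : v ∉ D.adj u) :
    wp (link D u v) fun D' c => Valid ε L D' ∧ D'.β = D.β ∧ D'.dens = D.dens ∧
      vol D'.adj = vol D.adj + 2 ∧ liftPotential L D' ≤ liftPotential L D + 2 * L ∧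
      c ≤ 4 * L + 9 := by
  have hnew' : u ∉ D.adj v := fun h => hnew (hD.graph.adj_symm _ _ h)
  unfold link
  simp only [wp_bind, wp_step]
  refine wp_bump_levels u List.nodup_range fun c₁ hc₁ => ?_
  refine wp_bump_levels v List.nodup_range fun c₂ hc₂ => ?_
  set adj := Function.update (Function.update D.adj u (v :: D.adj u)) v
    (u :: Function.update D.adj u (v :: D.adj u) v) with hadj
  have hadj_apply : ∀ w, adj w = if w = v then u :: D.adj v else if w = u then v :: D.adj u
      else D.adj w := by
    intro w
    rw [hadj]
    by_cases h1 : w = v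
    · subst h1; simp [huv.symm]
    · by_cases h2 : w = u
      · subst h2; simp [huv]
      · simp [h1, h2]
  have hmem : ∀ x w, x ∈ adj w ↔ x ∈ D.adj w ∨ (x = u ∧ w = v) ∨ (x = v ∧ w = u) := by
    intro x w
    rw [hadj_apply]
    by_cases h1 : w = v
    · subst h1; simp [huv.symm, or_comm]
    · by_cases h2 : w = u
      · subst h2; simp [huv, or_comm]
      · simp [h1, h2]
  have hlu := hD.levels.lvl_lt u
  have hlv := hD.levels.lvl_lt v
  have hsum : ∀ g : V → ℕ, ∑ w, (adj w).length * g w = ∑ w, (D.adj w).length * g w + (g u + g v) := by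
    intro g
    have h1 : ∀ w, (adj w).length * g w = (D.adj w).length * g w +
        ((if w = u then g w else 0) + if w = v then g w else 0) := by
      intro w
      rw [hadj_apply]
      by_cases h1 : w = v
      · subst h1; simp [huv.symm]; ring
      · by_cases h2 : w = u
        · subst h2; simp [huv]; ring
        · simp [h1, h2]
    rw [Finset.sum_congr rfl fun w _ => h1 w, Finset.sum_add_distrib, Finset.sum_add_distrib]
    simp
  have hup : ∀ w j, upDeg adj D.lvl w j = upDeg D.adj D.lvl w j +
      (if w = u ∧ j ≤ D.lvl v then 1 else 0) + if w = v ∧ j ≤ D.lvl u then 1 else 0 := by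
    intro w j
    unfold upDeg
    rw [hadj_apply]
    by_cases h1 : w = v
    · subst h1; simp [huv.symm, List.countP_cons]
    · by_cases h2 : w = u
      · subst h2; simp [huv, List.countP_cons]
      · simp [h1, h2]
  refine ⟨⟨⟨?_, ?_, ?_, ?_, ?_⟩, ⟨hD.guess.β_ge, hD.guess.dens_nonneg, hD.guess.dens_le⟩,
    ⟨hD.levels.lvl_lt, ?_⟩, ?_⟩, trivial, trivial, ?_, ?_, ?_⟩
  · intro w
    simp only
    rw [hadj_apply]
    split_ifs with h1 h2
    · exact List.nodup_cons.2 ⟨hnew', hD.graph.adj_nodup v⟩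
    · exact List.nodup_cons.2 ⟨hnew, hD.graph.adj_nodup u⟩
    · exact hD.graph.adj_nodup w
  · intro x w hw
    simp only at hw ⊢
    rw [hmem] at hw ⊢
    rcases hw with hw | hw | hw
    · exact Or.inl (hD.graph.adj_symm _ _ hw)
    · exact Or.inr (Or.inr ⟨hw.2, hw.1⟩)
    · exact Or.inr (Or.inl ⟨hw.2, hw.1⟩)
  · intro x w
    simp only
    rw [hmem, ← hD.graph.hasEdge_iff]
    by_cases h1 : x = v
    · subst h1
      by_cases h3 : w = u <;> simp [h3, huv.symm]
    · by_cases h2 : x = u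
      · subst h2
        by_cases h3 : w = v <;> simp [h3, huv]
      · simp [h1, h2]
  · have hmv := hD.graph.mem_verts
    have hnd := hD.graph.verts_nodup
    simp only [List.isEmpty_iff]
    split_ifs with h1 h2 h2 <;> simp [hmv, h1, h2, hnd, huv.symm]
  · intro w
    simp only [List.isEmpty_iff]
    rw [hadj_apply]
    have hmv := hD.graph.mem_verts
    by_cases h1 : w = v
    · subst h1
      simp only [if_true]
      split_ifs <;> simp_all
    · by_cases h2 : w = u
      · subst h2
        simp only [h1, if_false, if_true]
        split_ifs <;> simp_all
      · simp only [h1, h2, if_false]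
        split_ifs <;> simp_all
  · intro w hw
    refine (hD.levels.le_upDeg w hw).trans (Nat.cast_le.2 ?_)
    simp only
    rw [hup]
    omega
  · intro w j
    simp only
    rw [hc₂, hc₁, hup, hD.counters]
    simp [List.mem_range]
  · have := hsum fun _ => 1
    simpa [vol] using this
  · have := hsum fun w => L - D.lvl w
    unfold liftPotential
    simp only
    omega
  · simp only [List.length_range]
    omega

/-- The two new units of `vol` raise the rebuild potential by 200 · L · gap ≤ 800 L², the dominant
term; the rise of the lift potential and the direct costs are linear in `L`. A rebuild is paid for
entirely by its own drop of potential. -/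
theorem wp_insert {ε : ℝ} (hε : 0 < ε) {L : ℕ} (hL : 1 ≤ L) (hn : 2 ≤ Fintype.card V)
    (hnL : (Fintype.card V : ℝ) ≤ (1 + ε) ^ L) {D : DensState V} (hD : Valid ε L D) {u v : V}
    (huv : u ≠ v) :
    wp (insert ε L D u v) fun D' c => Valid ε L D' ∧ D.dens ≤ D'.dens ∧
      c + potential ε L D' ≤ potential ε L D + 1000 * L ^ 2 := by
  have hLL : L ≤ L ^ 2 := Nat.le_self_pow (by norm_num) L
  unfold insert
  simp only [wp_bind, wp_step]
  refine wp_ite _ _ _ _ (fun h => ?_) (fun h => ?_)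
  · simp only [wp_pure]
    exact ⟨hD, le_rfl, by omega⟩
  have hnew : v ∉ D.adj u := fun hm => h ((hD.graph.hasEdge_iff u v).2 hm)
  simp only [wp_bind]
  refine (wp_link hD huv hnew).mono ?_
  rintro D₁ c₁ ⟨hD₁, hβ₁, hdens₁, hvol₁, hlift₁, hc₁⟩
  refine (wp_propagate hε hD₁ [u, v]).mono ?_
  rintro ⟨again, D₂⟩ c₂ ⟨hD₂, hadj₂, hβ₂, hdens₂, hover, hc₂⟩
  simp only at hD₂ hadj₂ hβ₂ hdens₂ hover hc₂
  simp only [List.length_cons, List.length_nil] at hc₂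
  have hpot : c₁ + c₂ + 2 + potential ε L D₂ ≤ potential ε L D + 1000 * L ^ 2 := by
    have hgap := gap_le hε hL hn hnL hD.guess.β_ge
    unfold potential
    rw [hadj₂, hβ₂, hβ₁, hvol₁]
    have h1 : 100 * ((vol D.adj + 2) * L) * gap ε (Fintype.card V) D.β =
      100 * (vol D.adj * L) * gap ε (Fintype.card V) D.β +
        200 * (L * gap ε (Fintype.card V) D.β) := by ring
    have h2 : L * gap ε (Fintype.card V) D.β ≤ L * (4 * L) := Nat.mul_le_mul_left _ hgap
    have h3 : L * (4 * L) = 4 * L ^ 2 := by ring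
    rw [h1]
    omega
  simp only [wp_step]
  refine wp_ite _ _ _ _ (fun h => ?_) (fun h => ?_)
  · refine (wp_rebuild hε hL hnL hD₂ (hover h)).mono ?_
    rintro D₃ c₃ ⟨hD₃, hdens₃, hc₃⟩
    exact ⟨hD₃, by linarith, by omega⟩
  · simp only [wp_pure]
    exact ⟨hD₂, by linarith, by omega⟩

theorem wp_insertAll {ε : ℝ} (hε : 0 < ε) {L : ℕ} (hL : 1 ≤ L) (hn : 2 ≤ Fintype.card V)
    (hnL : (Fintype.card V : ℝ) ≤ (1 + ε) ^ L) {D : DensState V} (hD : Valid ε L D)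
    {es : List (V × V)} (hes : ∀ e ∈ es, e.1 ≠ e.2) :
    wp (insertAll ε L D es) fun D' c => Valid ε L D' ∧ D.dens ≤ D'.dens ∧
      c + potential ε L D' ≤ potential ε L D + es.length * (1001 * L ^ 2) + 1 := by
  have hL2 : 1 ≤ L ^ 2 := Nat.one_le_pow _ _ hL
  unfold insertAll
  refine wp_forEach (fun done D' c => Valid ε L D' ∧ D.dens ≤ D'.dens ∧
    c + potential ε L D' ≤ potential ε L D + done.length * (1001 * L ^ 2))
    ⟨hD, le_rfl, by simp⟩ ?_ ?_
  · rintro done e rest D₁ c₁ hl ⟨hD₁, hdens₁, hc₁⟩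
    refine (wp_insert hε hL hn hnL hD₁ (hes e (by simp [hl]))).mono ?_
    rintro D₂ c₂ ⟨hD₂, hdens₂, hc₂⟩
    refine ⟨hD₂, hdens₁.trans hdens₂, ?_⟩
    rw [List.length_append, List.length_singleton, add_mul]
    omega
  · rintro D₁ c₁ ⟨hD₁, hdens₁, hc₁⟩
    exact ⟨hD₁, hdens₁, by omega⟩

end ApprDens

/-! ### The number of levels and the input lists -/

open Timed in
theorem wp_levelCount {ε : ℝ} (hε : 0 < ε) (n : ℕ) :
    wp (levelCount ε n) fun L c => (n : ℝ) ≤ (1 + ε) ^ L ∧ (L = 0 ∨ (1 + ε) ^ (L - 1) < (n : ℝ)) ∧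
      c = L + 1 := by
  obtain ⟨N, hN⟩ := pow_unbounded_of_one_lt (n : ℝ) (by linarith : 1 < 1 + ε)
  refine wp_loop (fun p c => p.2 = (1 + ε) ^ p.1 ∧ c = p.1 ∧
    (p.1 = 0 ∨ (1 + ε) ^ (p.1 - 1) < (n : ℝ))) (fun p => N - p.1) (by simp) ?_
  rintro ⟨L, x⟩ c ⟨hx, hc, hL⟩
  simp only at hx hc hL
  obtain rfl : L = c := hc.symm
  subst hx
  simp only [wp_step]
  split_ifs with h
  · exact ⟨h, hL, rfl⟩
  · rw [not_le] at h
    have hlt : L < N := (pow_lt_pow_iff_right₀ (by linarith : 1 < 1 + ε)).1 (h.trans hN)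
    simp only [Sum.elim_inr]
    exact ⟨⟨(pow_succ _ _).symm, trivial, Or.inr (by simpa using h)⟩, by omega⟩

namespace TemporalGraph

variable {V : Type} {G : TemporalGraph V}

theorem EdgeListing.length_edges (E : G.EdgeListing) {t : ℕ} (ht : t ∈ Finset.Icc 1 G.r) :
    (E.edges t).length = (G.edgesAt t).ncard := by
  classical
  have h : G.edgesAt t = ((E.edges t).map fun e => s(e.1, e.2)).toFinset := by
    ext e
    rw [List.coe_toFinset]
    exact (E.mem_iff t ht e).symm
  rw [h, Set.ncard_coe_finset, List.toFinset_card_of_nodup (E.nodup t ht), List.length_map]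

theorem EdgeListing.sum_length_edges (E : G.EdgeListing) :
    ((List.range' 1 G.r).map fun t => (E.edges t).length).sum = G.numEdges := by
  have h : Finset.Icc 1 G.r = (List.range' 1 G.r).toFinset := by
    ext t
    simp only [Finset.mem_Icc, List.mem_toFinset, List.mem_range'_1]
    omega
  rw [numEdges, ← Finset.sum_congr rfl fun t ht => E.length_edges ht, h,
    List.sum_toFinset _ List.nodup_range']

theorem EdgeListing.ne_of_mem (E : G.EdgeListing) {t : ℕ} (ht : t ∈ Finset.Icc 1 G.r)
    {e : V × V} (he : e ∈ E.edges t) : e.1 ≠ e.2 := by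
  obtain ⟨u, v, huv, h⟩ := (E.mem_iff t ht s(e.1, e.2)).1 (List.mem_map_of_mem he)
  intro hee
  rw [hee, Sym2.eq_iff] at huv
  have : u = v := by rcases huv with ⟨h1, h2⟩ | ⟨h1, h2⟩ <;> rw [← h1, ← h2]
  subst this
  simp [G.loopless] at h

theorem two_le_card [Fintype V] (h : 1 ≤ G.numEdges) : 2 ≤ Fintype.card V := by
  obtain ⟨t, -, ht⟩ := Finset.exists_ne_zero_of_sum_ne_zero (Nat.one_le_iff_ne_zero.1 h)
  obtain ⟨e, u, v, -, huv⟩ := Set.nonempty_of_ncard_ne_zero ht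
  refine Fintype.one_lt_card_iff.2 ⟨u, v, ?_⟩
  rintro rfl
  simp [G.loopless] at huv

end TemporalGraph

theorem List.eq_of_range'_eq_append {a r i : ℕ} {done rest : List ℕ}
    (h : List.range' a r = done ++ i :: rest) : i = a + done.length ∧ done.length < r := by
  have hlen := congrArg List.length h
  simp only [List.length_range', List.length_append, List.length_cons] at hlen
  have hi : (List.range' a r)[done.length]'(by simp; omega) = i := by simp [h]
  rw [List.getElem_range'] at hi
  omega

namespace ApproxDP

open Timed ApprDens

variable {V : Type}

/-! ### Sparsification -/

/-- For the first two survivors `a`, `y`, the slack 2·hi - f a - f y bounds δ times the number of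
further survivors. Prepending a survivor enlarges the slack by the difference of values two places
apart, which exceeds δ. With only two survivors the slack may be 0, hence the alternative `tl' =
[]`. -/
theorem wp_sprsFrom (f : ℕ → ℝ) (δ hi : ℝ) (a : ℕ × DensState V) (A : List (ℕ × DensState V))
    (hmono : (a :: A).Pairwise fun x y => f x.1 ≤ f y.1) (hhi : ∀ x ∈ a :: A, f x.1 ≤ hi) :
    wp (sprsFrom f δ a A) fun out c => ∃ tl, out = a :: tl ∧ tl.Sublist A ∧
      (∀ y tl', tl = y :: tl' → tl' = [] ∨ (tl'.length : ℝ) * δ < 2 * hi - f a.1 - f y.1) ∧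
      c ≤ 2 * A.length + 1 := by
  match A with
  | [] =>
    simp only [sprsFrom, wp_step]
    exact ⟨[], rfl, List.Sublist.refl _, by simp, by simp⟩
  | [b] =>
    simp only [sprsFrom, wp_step]
    exact ⟨[b], rfl, List.Sublist.refl _, by simp, by simp⟩
  | b :: c :: A =>
    rw [sprsFrom]
    simp only [wp_bind, wp_step]
    refine wp_ite _ _ _ _ (fun h => ?_) (fun h => ?_)
    · refine (wp_sprsFrom f δ hi a (c :: A)
        (hmono.sublist (List.Sublist.cons_cons a (List.sublist_cons_self b _)))
        fun x hx => hhi x ?_).mono ?_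
      · simp only [List.mem_cons] at hx ⊢
        tauto
      · rintro out d ⟨tl, rfl, h1, h2, h3⟩
        refine ⟨tl, rfl, h1.trans (List.sublist_cons_self _ _), h2, ?_⟩
        simp only [List.length_cons] at h3 ⊢
        omega
    · have hδ : δ < f c.1 - f a.1 := by simpa only [decide_eq_true_eq, not_le] using h
      rw [List.pairwise_cons] at hmono
      simp only [wp_bind]
      refine (wp_sprsFrom f δ hi b (c :: A) hmono.2
        fun x hx => hhi x (List.mem_cons_of_mem _ hx)).mono ?_
      rintro out d ⟨tl, rfl, h1, h2, h3⟩
      simp only [wp_step]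
      refine ⟨b :: tl, rfl, h1.cons_cons b, ?_, ?_⟩
      · intro y tl' hy
        obtain ⟨rfl, rfl⟩ := List.cons.inj hy
        rcases tl with _ | ⟨z, tl⟩
        · exact Or.inl rfl
        right
        -- The third survivor `z` need not be `c`, but it comes no earlier, so monotonicity
        -- transfers f c - f a > δ to `z`.
        have hz : z ∈ c :: A := h1.subset (by simp)
        have hcz : f c.1 ≤ f z.1 := by
          rcases List.mem_cons.1 hz with rfl | hz
          · exact le_rfl
          · exact (List.pairwise_cons.1 (List.pairwise_cons.1 hmono.2).2).1 z hz
        have hzhi := hhi z (by simp only [List.mem_cons] at hz ⊢; tauto)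
        have hbhi := hhi b (by simp)
        rcases h2 z tl rfl with rfl | h2
        · simp only [List.length_cons, List.length_nil]
          push_cast
          linarith
        · simp only [List.length_cons]
          push_cast
          linarith
      · simp only [List.length_cons] at h3 ⊢
        omega
  termination_by A.length

theorem wp_sprs {f : ℕ → ℝ} {δ hi : ℝ} (hf : ∀ a, 0 ≤ f a) {A : List (ℕ × DensState V)}
    (hmono : A.Pairwise fun x y => f x.1 ≤ f y.1) (hhi : ∀ x ∈ A, f x.1 ≤ hi) :
    wp (sprs f δ A) fun out c => out.Sublist A ∧
      (out.length ≤ 2 ∨ ((out.length : ℝ) - 2) * δ < 2 * hi) ∧ c ≤ 2 * A.length + 1 := by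
  cases A with
  | nil => simp [sprs]
  | cons a A =>
    rw [sprs]
    refine (wp_sprsFrom f δ hi a A hmono hhi).mono ?_
    rintro out c ⟨tl, rfl, h1, h2, h3⟩
    refine ⟨h1.cons_cons a, ?_, by simp only [List.length_cons]; omega⟩
    rcases tl with _ | ⟨y, tl⟩
    · simp
    rcases h2 y tl rfl with rfl | h2
    · simp
    · right
      have ha := hf a.1
      have hy := hf y.1
      simp only [List.length_cons]
      push_cast
      linarith

theorem length_le_of_gap {len k ℓ K : ℕ} {x ε₁ : ℝ} (hε₁ : 0 < ε₁) (hk : 1 ≤ k) (hℓ : ℓ ≤ k)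
    (hx : 0 ≤ x) (hK : 2 * (k * (1 + ε₁)) / ε₁ + 2 ≤ (K : ℝ))
    (h : len ≤ 2 ∨ ((len : ℝ) - 2) * (x * (ε₁ / (k + ℓ * ε₁))) < 2 * x) : len ≤ K := by
  have hk' : (1 : ℝ) ≤ k := by exact_mod_cast hk
  have hℓ' : (ℓ : ℝ) ≤ k := by exact_mod_cast hℓ
  rcases h with h | h
  · have : (2 : ℝ) ≤ K := le_trans (by
      have : 0 ≤ 2 * (k * (1 + ε₁)) / ε₁ := by positivity
      linarith) hK
    exact h.trans (by exact_mod_cast this)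
  · rcases hx.eq_or_lt with rfl | hx
    -- For `x = 0` the strict inequality reads 0 < 0, so only the bound 2 remains.
    · simp at h
    have hpos : 0 < (k : ℝ) + ℓ * ε₁ := by positivity
    have h1 : ((len : ℝ) - 2) * (ε₁ / (k + ℓ * ε₁)) < 2 := by
      refine lt_of_mul_lt_mul_left (a := x) ?_ hx.le
      linarith
    rw [← mul_div_assoc, div_lt_iff₀ hpos] at h1
    have h2 : (len : ℝ) - 2 < 2 * (k * (1 + ε₁)) / ε₁ := by
      rw [lt_div_iff₀ hε₁]
      nlinarith
    have h3 : (len : ℝ) ≤ K := by linarith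
    exact_mod_cast h3

/-! ### The profit table -/

theorem setCell_apply (s : ℕ → ℕ → ℝ) (i ℓ : ℕ) (x : ℝ) (a b : ℕ) :
    setCell s i ℓ x a b = if a = i ∧ b = ℓ then x else s a b := by
  unfold setCell
  by_cases h : a = i
  · subst h
    by_cases h' : b = ℓ
    · subst h'; simp
    · simp [h']
  · simp [h]

/-- Column `ℓ` of the table is monotone up to row `b`. -/
def MonoCol (s : ℕ → ℕ → ℝ) (ℓ b : ℕ) : Prop := ∀ i j, i ≤ j → j ≤ b → s i ℓ ≤ s j ℓ

theorem MonoCol.setCell_ne {s : ℕ → ℕ → ℝ} {ℓ ℓ' b : ℕ} (h : MonoCol s ℓ' b) (hne : ℓ' ≠ ℓ)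
    (i : ℕ) (x : ℝ) : MonoCol (setCell s i ℓ x) ℓ' b := by
  intro a c hac hc
  simpa [setCell_apply, hne] using h a c hac hc

theorem MonoCol.setCell_succ {s : ℕ → ℕ → ℝ} {ℓ b : ℕ} (h : MonoCol s ℓ b) {x : ℝ}
    (hx : s b ℓ ≤ x) : MonoCol (setCell s (b + 1) ℓ x) ℓ (b + 1) := by
  intro i j hij hj
  simp only [setCell_apply, and_true]
  by_cases h1 : j = b + 1
  · by_cases h2 : i = b + 1
    · simp [h1, h2]
    · simpa [h1, h2] using (h i b (by omega) le_rfl).trans hx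
  · rw [if_neg h1, if_neg (by omega)]
    exact h i j hij (by omega)

theorem setCell_nonneg {s : ℕ → ℕ → ℝ} (h : ∀ i j, 0 ≤ s i j) {x : ℝ} (hx : 0 ≤ x) (i ℓ : ℕ)
    (a b : ℕ) : 0 ≤ setCell s i ℓ x a b := by
  rw [setCell_apply]
  split_ifs
  exacts [hx, h a b]

variable [DecidableEq V] [Fintype V]

/-- Monotonicity comes from the recorded density, which no insertion decreases. -/
theorem wp_firstColumn {ε : ℝ} (hε : 0 < ε) {L : ℕ} (hL : 1 ≤ L) (hn : 2 ≤ Fintype.card V)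
    (hnL : (Fintype.card V : ℝ) ≤ (1 + ε) ^ L) {r : ℕ} {E : ℕ → List (V × V)}
    (hE : ∀ t ∈ Finset.Icc 1 r, ∀ e ∈ E t, e.1 ≠ e.2) :
    wp (firstColumn ε L r E fun _ _ => 0) fun s c => (∀ i j, 0 ≤ s i j) ∧ MonoCol s 1 r ∧
      c ≤ ((List.range' 1 r).map fun i => (E i).length).sum * (1001 * L ^ 2) + 3 * r + 2 := by
  unfold firstColumn
  simp only [wp_bind]
  refine (wp_init hε hL).mono ?_
  rintro D₀ c₀ ⟨hD₀, hdens₀, hpot₀, rfl⟩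
  refine wp_forEach (fun done p c => (∀ i j, 0 ≤ p.1 i j) ∧ MonoCol p.1 1 done.length ∧
    p.1 done.length 1 ≤ p.2.dens ∧ Valid ε L p.2 ∧ c + potential ε L p.2 ≤
      (done.map fun i => (E i).length).sum * (1001 * L ^ 2) + 3 * done.length) ?_ ?_ ?_
  · exact ⟨fun _ _ => le_rfl, fun _ _ _ _ => le_rfl, by simp [hdens₀], hD₀, by simp [hpot₀]⟩
  · rintro done i rest ⟨s, D⟩ c hl ⟨hs, hmono, hdens, hD, hc⟩
    obtain ⟨rfl, hlt⟩ := List.eq_of_range'_eq_append hl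
    simp only at hs hmono hdens hD hc
    simp only [wp_bind]
    refine (wp_insertAll hε hL hn hnL hD
      (hE _ (Finset.mem_Icc.2 ⟨by omega, by omega⟩))).mono ?_
    rintro D' d ⟨hD', hdens', hd⟩
    simp only [wp_step, wp_pure, List.length_append, List.length_singleton, List.map_append,
      List.sum_append, List.map_cons, List.map_nil, List.sum_cons, List.sum_nil, add_zero]
    rw [add_comm 1 done.length] at hd ⊢
    refine ⟨setCell_nonneg hs hD'.guess.dens_nonneg _ _, hmono.setCell_succ (hdens.trans hdens'),
      by simp [setCell_apply], hD', ?_⟩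
    rw [add_mul]
    omega
  · rintro ⟨s, D⟩ c ⟨hs, hmono, -, -, hc⟩
    simp only [List.length_range'] at hs hmono hc
    simp only [wp_pure]
    exact ⟨hs, hmono, by omega⟩

/-! ### Candidates, rounds and columns -/

/-- The invariant of the list of candidates before round `i`. -/
structure CandidatesOK (ε : ℝ) (L i : ℕ) (A : List (ℕ × DensState V)) : Prop where
  sorted : A.Pairwise fun x y => x.1 < y.1
  lt : ∀ c ∈ A, c.1 < i
  valid : ∀ c ∈ A, Valid ε L c.2

/-- The sum of the potentials of all instances. -/
noncomputable def totalPotential (ε : ℝ) (L : ℕ) (A : List (ℕ × DensState V)) : ℕ :=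
  (A.map fun c => potential ε L c.2).sum

theorem wp_insert_candidates {ε : ℝ} (hε : 0 < ε) {L : ℕ} (hL : 1 ≤ L) (hn : 2 ≤ Fintype.card V)
    (hnL : (Fintype.card V : ℝ) ≤ (1 + ε) ^ L) {es : List (V × V)} (hes : ∀ e ∈ es, e.1 ≠ e.2)
    {A : List (ℕ × DensState V)} (hA : ∀ c ∈ A, Valid ε L c.2) (g : ℕ → ℝ) (x₀ : ℝ) :
    wp (forEach A (([] : List (ℕ × DensState V)), x₀) fun p c => do
      let D ← ApprDens.insertAll ε L c.2 es
      step (p.1 ++ [(c.1, D)], max p.2 (g c.1 + D.dens))) fun p c =>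
      p.1.map Prod.fst = A.map Prod.fst ∧ (∀ c ∈ p.1, Valid ε L c.2) ∧ x₀ ≤ p.2 ∧
      c + totalPotential ε L p.1 ≤
        totalPotential ε L A + A.length * (es.length * (1001 * L ^ 2) + 3) + 1 := by
  refine wp_forEach (fun done p c => p.1.map Prod.fst = done.map Prod.fst ∧
    (∀ c ∈ p.1, Valid ε L c.2) ∧ x₀ ≤ p.2 ∧ c + totalPotential ε L p.1 ≤
      totalPotential ε L done + done.length * (es.length * (1001 * L ^ 2) + 3)) ?_ ?_ ?_
  · simp [totalPotential]
  · rintro done ⟨a, D⟩ rest ⟨B, x⟩ c hl ⟨hfst, hB, hx, hc⟩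
    simp only at hfst hB hx hc
    simp only [wp_bind]
    refine (wp_insertAll hε hL hn hnL (hA (a, D) (by simp [hl])) hes).mono ?_
    rintro D' d ⟨hD', -, hd⟩
    simp only [wp_step]
    refine ⟨by simp [hfst], ?_, hx.trans (le_max_left _ _), ?_⟩
    · intro c hc
      rcases List.mem_append.1 hc with hc | hc
      · exact hB c hc
      · rw [List.mem_singleton.1 hc]; exact hD'
    · simp only [totalPotential, List.map_append, List.sum_append, List.length_append,
        List.length_singleton, List.map_cons, List.map_nil, List.sum_cons, List.sum_nil] at hc hd ⊢
      rw [add_mul]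
      omega
  · rintro ⟨B, x⟩ c ⟨hfst, hB, hx, hc⟩
    exact ⟨hfst, hB, hx, by omega⟩

/-- During the round the list has at most `K + 1` candidates; sparsification brings it back to `K`.
The 12 covers the overhead per candidate and that of the round. -/
theorem wp_round {ε : ℝ} (hε : 0 < ε) {L : ℕ} (hL : 1 ≤ L) (hn : 2 ≤ Fintype.card V)
    (hnL : (Fintype.card V : ℝ) ≤ (1 + ε) ^ L) {r : ℕ} {E : ℕ → List (V × V)}
    (hE : ∀ t ∈ Finset.Icc 1 r, ∀ e ∈ E t, e.1 ≠ e.2) (shift : ℕ) {ε₁ : ℝ} (hε₁ : 0 < ε₁)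
    {k ℓ K : ℕ} (hℓ : 2 ≤ ℓ) (hℓk : ℓ ≤ k) (hK : 2 * (k * (1 + ε₁)) / ε₁ + 2 ≤ (K : ℝ))
    {s : ℕ → ℕ → ℝ} (hs : ∀ i j, 0 ≤ s i j) (hmono : MonoCol s (ℓ - 1) r) {i : ℕ} (hi : i < r)
    {A : List (ℕ × DensState V)} (hA : CandidatesOK ε L (i + 1) A) (hAK : A.length ≤ K) :
    wp (round shift ε₁ ε k L E ℓ s A (i + 1)) fun p c => (∃ x, 0 ≤ x ∧ s i ℓ ≤ x ∧
      p.1 = setCell s (i + 1) ℓ x) ∧ CandidatesOK ε L (i + 2) p.2 ∧ p.2.length ≤ K ∧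
      c + totalPotential ε L p.2 ≤ totalPotential ε L A +
        (K + 1) * ((E (i + 1)).length * (1001 * L ^ 2) + 12) := by
  unfold round
  simp only [wp_bind]
  refine (wp_init hε hL).mono ?_
  rintro D₀ c₀ ⟨hD₀, -, hpot₀, rfl⟩
  simp only [wp_step]
  refine (wp_insert_candidates hε hL hn hnL (hE (i + 1) (Finset.mem_Icc.2 ⟨by omega, by omega⟩))
    (A := A ++ [(i + 1, D₀)]) ?_ (fun a => s (a - 1) (ℓ - 1)) _).mono ?_
  · intro c hc
    rcases List.mem_append.1 hc with hc | hc
    · exact hA.valid c hc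
    · rw [List.mem_singleton.1 hc]; exact hD₀
  rintro ⟨B, x⟩ c ⟨hfst, hB, hx, hc⟩
  simp only at hfst hB hx hc
  have hx1 : s i ℓ ≤ x := le_trans (le_max_left _ _) hx
  have hx2 : s (i + 1) (ℓ - 1) ≤ x := le_trans (le_max_right _ _) hx
  have hx0 : 0 ≤ x := (hs _ _).trans hx1
  have hBsorted : B.Pairwise fun x y => x.1 < y.1 := by
    have : (A ++ [(i + 1, D₀)]).Pairwise fun x y => x.1 < y.1 :=
      List.pairwise_append.2 ⟨hA.sorted, List.pairwise_singleton _ _, fun a ha b hb => by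
        rw [List.mem_singleton.1 hb]; exact hA.lt a ha⟩
    rw [← List.pairwise_map (f := Prod.fst) (R := (· < ·)), ← hfst] at this
    exact List.pairwise_map.1 this
  have hBle : ∀ c ∈ B, c.1 < i + 2 := by
    intro c hc
    have h := List.mem_map_of_mem (f := Prod.fst) hc
    rw [hfst, List.map_append, List.mem_append] at h
    rcases h with h | h
    · obtain ⟨d, hd, hdc⟩ := List.mem_map.1 h
      have := hA.lt d hd
      omega
    · simp only [List.map_cons, List.map_nil, List.mem_singleton] at h
      omega
  have hBlen : B.length = A.length + 1 := by
    have := congrArg List.length hfst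
    simpa using this
  have hmono' := hmono.setCell_ne (by omega : ℓ - 1 ≠ ℓ) (i + 1) x
  refine (wp_sprs (hi := x) (fun a => setCell_nonneg hs hx0 (i + 1) ℓ (a - shift) (ℓ - 1)) ?_
    ?_).mono ?_
  · refine hBsorted.imp_of_mem fun {a b} _ hb hab => hmono' _ _ (by omega) ?_
    have := hBle b hb
    omega
  · intro c hc
    have := hBle c hc
    -- All compared values are at most s[i+1, ℓ-1], which is one of the terms in the maximum `x`.
    refine (hmono' _ (i + 1) (by omega) (by omega)).trans ?_
    rwa [setCell_apply, if_neg (by omega)]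
  rintro A' d ⟨hsub, hlen, hd⟩
  simp only at hd
  simp only [wp_pure]
  refine ⟨⟨x, hx0, hx1, rfl⟩, ⟨hBsorted.sublist hsub, fun c hc => hBle c (hsub.subset hc),
    fun c hc => hB c (hsub.subset hc)⟩, length_le_of_gap hε₁ (by omega) hℓk hx0 hK hlen, ?_⟩
  -- Potentials are nonnegative, so dropping instances cannot increase the sum.
  have hpot : totalPotential ε L A' ≤ totalPotential ε L B :=
    (hsub.map _).sum_le_sum (by simp)
  have hpotA : totalPotential ε L (A ++ [(i + 1, D₀)]) = totalPotential ε L A := by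
    simp [totalPotential, hpot₀]
  rw [hpotA, List.length_append, List.length_singleton] at hc
  have hmul : (A.length + 1) * ((E (i + 1)).length * (1001 * L ^ 2) + 3) ≤
      (K + 1) * ((E (i + 1)).length * (1001 * L ^ 2) + 3) :=
    Nat.mul_le_mul_right _ (by omega)
  have hexp : (K + 1) * ((E (i + 1)).length * (1001 * L ^ 2) + 12) =
    (K + 1) * ((E (i + 1)).length * (1001 * L ^ 2) + 3) + 9 * K + 9 := by ring
  omega

theorem wp_column {ε : ℝ} (hε : 0 < ε) {L : ℕ} (hL : 1 ≤ L) (hn : 2 ≤ Fintype.card V)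
    (hnL : (Fintype.card V : ℝ) ≤ (1 + ε) ^ L) {r : ℕ} {E : ℕ → List (V × V)}
    (hE : ∀ t ∈ Finset.Icc 1 r, ∀ e ∈ E t, e.1 ≠ e.2) (shift : ℕ) {ε₁ : ℝ} (hε₁ : 0 < ε₁)
    {k ℓ K : ℕ} (hℓ : 2 ≤ ℓ) (hℓk : ℓ ≤ k) (hK : 2 * (k * (1 + ε₁)) / ε₁ + 2 ≤ (K : ℝ))
    {s : ℕ → ℕ → ℝ} (hs : ∀ i j, 0 ≤ s i j) (hmono : MonoCol s (ℓ - 1) r) :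
    wp (forEach (List.range' 1 r) (s, ([] : List (ℕ × DensState V))) fun p i =>
      round shift ε₁ ε k L E ℓ p.1 p.2 i) fun p c =>
      (∀ i j, 0 ≤ p.1 i j) ∧ MonoCol p.1 ℓ r ∧ c ≤ (K + 1) *
        (((List.range' 1 r).map fun i => (E i).length).sum * (1001 * L ^ 2) + 12 * r) + r + 1 := by
  refine wp_forEach (fun done p c => (∀ i j, 0 ≤ p.1 i j) ∧ MonoCol p.1 (ℓ - 1) r ∧
    MonoCol p.1 ℓ done.length ∧ CandidatesOK ε L (done.length + 1) p.2 ∧ p.2.length ≤ K ∧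
    c + totalPotential ε L p.2 ≤ (K + 1) *
      ((done.map fun i => (E i).length).sum * (1001 * L ^ 2) + 12 * done.length) + done.length)
    ?_ ?_ ?_
  · refine ⟨hs, hmono, ?_, ⟨by simp, by simp, by simp⟩, by simp, by simp [totalPotential]⟩
    intro i j hij hj
    simp only [List.length_nil] at hj
    rw [(by omega : i = j)]
  · rintro done i rest ⟨s, A⟩ c hl ⟨hs, hmono, hcol, hA, hAK, hc⟩
    obtain ⟨rfl, hlt⟩ := List.eq_of_range'_eq_append hl
    simp only at hs hmono hcol hA hAK hc
    rw [add_comm 1 done.length]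
    refine (wp_round hε hL hn hnL hE shift hε₁ hℓ hℓk hK hs hmono hlt hA hAK).mono ?_
    rintro ⟨s', A'⟩ d ⟨⟨x, hx0, hx, rfl⟩, hA', hAK', hd⟩
    simp only at hA' hAK' hd
    simp only [List.length_append, List.length_singleton, List.map_append,
      List.sum_append, List.map_cons, List.map_nil, List.sum_cons, List.sum_nil]
    refine ⟨setCell_nonneg hs hx0 _ _, hmono.setCell_ne (by omega) _ _, hcol.setCell_succ hx,
      hA', hAK', ?_⟩
    have hexp : ∀ S e N : ℕ, (K + 1) * ((S + (e + 0)) * (1001 * L ^ 2) + 12 * (N + 1)) =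
        (K + 1) * (S * (1001 * L ^ 2) + 12 * N) + (K + 1) * (e * (1001 * L ^ 2) + 12) := by
      intros; ring
    rw [hexp]
    omega
  · rintro ⟨s, A⟩ c ⟨hs, -, hcol, -, -, hc⟩
    simp only [List.length_range'] at hs hcol hc
    exact ⟨hs, hcol, by omega⟩

/-- With `r ≤ m` and `1 ≤ L`, all overheads are absorbed into k(K+1)mL². Monotonicity of each
finished column is what bounds the candidates of the next. -/
theorem wp_run {G : TemporalGraph V} (E : G.EdgeListing) (hm : 1 ≤ G.numEdges)
    (hr : G.r ≤ G.numEdges) (shift : ℕ) {ε₁ ε₂ : ℝ} (hε₁ : 0 < ε₁) (hε₂ : 0 < ε₂) {k K : ℕ}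
    (hk : 1 ≤ k) (hK : 2 * (k * (1 + ε₁)) / ε₁ + 2 ≤ (K : ℝ)) :
    wp (run shift ε₁ ε₂ k (Fintype.card V) G.r E.edges) fun _ c =>
      ∃ L : ℕ, 1 ≤ L ∧ (1 + min ε₂ 1 / 3) ^ (L - 1) < (Fintype.card V : ℝ) ∧
        c ≤ 2100 * (k * (K + 1) * (G.numEdges * L ^ 2)) := by
  have hε : 0 < min ε₂ 1 / 3 := by positivity
  have hn := G.two_le_card hm
  have hE : ∀ t ∈ Finset.Icc 1 G.r, ∀ e ∈ E.edges t, e.1 ≠ e.2 := fun t ht e => E.ne_of_mem ht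
  unfold run
  simp only [wp_bind, wp_step]
  refine (wp_levelCount hε _).mono ?_
  rintro L c₀ ⟨hnL, hL, rfl⟩
  have hL1 : 1 ≤ L := by
    rcases Nat.eq_zero_or_pos L with rfl | h
    · have : (2 : ℝ) ≤ (Fintype.card V : ℝ) := by exact_mod_cast hn
      rw [pow_zero] at hnL
      linarith
    · exact h
  have hLn := hL.resolve_left (by omega)
  refine (wp_firstColumn hε hL1 hn hnL hE).mono ?_
  rintro s₁ c₁ ⟨hs₁, hmono₁, hc₁⟩
  rw [E.sum_length_edges] at hc₁
  set B := (K + 1) * (G.numEdges * (1001 * L ^ 2) + 12 * G.r) + G.r + 2 with hB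
  refine wp_forEach (fun done s c => (∀ i j, 0 ≤ s i j) ∧ MonoCol s (done.length + 1) G.r ∧
    c ≤ done.length * B) ⟨hs₁, by simpa using hmono₁, by simp⟩ ?_ ?_
  · rintro done ℓ rest s c hl ⟨hs, hmono, hc⟩
    obtain ⟨rfl, hlt⟩ := List.eq_of_range'_eq_append hl
    have hsub : 2 + done.length - 1 = done.length + 1 := by omega
    simp only [wp_bind]
    refine (wp_column hε hL1 hn hnL hE shift hε₁ (by omega) (by omega) hK hs
      (by rwa [hsub])).mono ?_
    rintro ⟨s', A⟩ d ⟨hs', hcol, hd⟩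
    simp only at hs' hcol hd
    rw [E.sum_length_edges] at hd
    simp only [wp_pure, List.length_append, List.length_singleton]
    refine ⟨hs', by rwa [add_comm 2] at hcol, ?_⟩
    rw [add_mul]
    omega
  · rintro s c ⟨-, -, hc⟩
    refine ⟨L, hL1, hLn, ?_⟩
    rw [List.length_range'] at hc
    have hLL : L ≤ L ^ 2 := Nat.le_self_pow (by norm_num) L
    set X := G.numEdges * L ^ 2 with hX
    have hL2 : 1 ≤ L ^ 2 := by omega
    have hmX : G.numEdges ≤ X := Nat.le_mul_of_pos_right _ hL2
    have hLX : L ^ 2 ≤ X := Nat.le_mul_of_pos_left _ hm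
    have e1 : G.numEdges * (1001 * L ^ 2) = 1001 * X := by rw [hX]; ring
    rw [e1] at hB hc₁
    have hKX : X ≤ (K + 1) * X := Nat.le_mul_of_pos_left _ (Nat.succ_pos K)
    have hBX : B ≤ 1016 * ((K + 1) * X) := by
      have h1 : (K + 1) * (1001 * X + 12 * G.r) ≤ (K + 1) * (1013 * X) :=
        Nat.mul_le_mul_left _ (by omega)
      have h2 : (K + 1) * (1013 * X) = 1013 * ((K + 1) * X) := by ring
      omega
    have h3 : (k - 1) * B ≤ k * (1016 * ((K + 1) * X)) := Nat.mul_le_mul (by omega) hBX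
    have h4 : k * (1016 * ((K + 1) * X)) = 1016 * (k * (K + 1) * X) := by ring
    have h5 : (K + 1) * X ≤ k * (K + 1) * X := by
      rw [mul_assoc]; exact Nat.le_mul_of_pos_left _ hk
    omega

/-! ### Logarithms and the final constant -/

theorem log_bound {n L : ℕ} (hn : 2 ≤ n) {ε₂ M : ℝ} (hε₂ : 0 < ε₂) (hM : ε₂ ≤ M) (hM1 : 1 ≤ M)
    (hL : (1 + min ε₂ 1 / 3) ^ (L - 1) < (n : ℝ)) :
    (L : ℝ) ≤ 12 * M * Real.log n / ε₂ := by
  set ε := min ε₂ 1 / 3 with hεdef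
  have hε : 0 < ε := by positivity
  have hε1 : ε ≤ 1 := by
    have := min_le_right ε₂ 1
    rw [hεdef]; linarith
  have hεM : ε₂ ≤ 3 * M * ε := by
    rw [hεdef]
    rcases le_total ε₂ 1 with h | h
    · rw [min_eq_left h]; nlinarith
    · rw [min_eq_right h]; linarith
  -- From log(1+ε) ≥ 1 - 1/(1+ε) = ε/(1+ε) and ε ≤ 1.
  have hlog : ε / 2 ≤ Real.log (1 + ε) := by
    refine le_trans ?_ (Real.one_sub_inv_le_log_of_pos (by linarith))
    have : 1 - (1 + ε)⁻¹ = ε / (1 + ε) := by field_simp; ring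
    rw [this]
    exact div_le_div_of_nonneg_left hε.le (by linarith) (by linarith)
  have hlogn : 1 / 2 ≤ Real.log n := by
    have h2 : Real.log 2 ≤ Real.log n := Real.log_le_log (by norm_num) (by exact_mod_cast hn)
    have := Real.log_two_gt_d9
    linarith
  have h1 : ((L - 1 : ℕ) : ℝ) * Real.log (1 + ε) ≤ Real.log n := by
    rw [← Real.log_pow]
    exact Real.log_le_log (by positivity) hL.le
  have h2 : (L : ℝ) ≤ ((L - 1 : ℕ) : ℝ) + 1 := by
    have : L ≤ (L - 1) + 1 := by omega
    exact_mod_cast this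
  -- This gives (L-1)ε ≤ 2 log n; the rounding term ε ≤ 1 ≤ 2 log n is absorbed because n ≥ 2.
  have h3 : ((L - 1 : ℕ) : ℝ) * (ε / 2) ≤ Real.log n :=
    (mul_le_mul_of_nonneg_left hlog (Nat.cast_nonneg _)).trans h1
  have h4 : (L : ℝ) * ε ≤ 4 * Real.log n := by nlinarith
  rw [le_div_iff₀ hε₂]
  calc (L : ℝ) * ε₂ ≤ L * (3 * M * ε) := by gcongr
    _ = 3 * M * (L * ε) := by ring
    _ ≤ 3 * M * (4 * Real.log n) := by gcongr
    _ = 12 * M * Real.log n := by ring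

end ApproxDP

theorem mainTheorem7 (M : ℝ) :
    ∃ C : ℝ, ∀ (V : Type) [Fintype V] [DecidableEq V] (G : TemporalGraph V) (E : G.EdgeListing)
      (k shift : ℕ) (ε₁ ε₂ : ℝ),
      1 ≤ k → shift ≤ 1 → 0 < ε₁ → ε₁ ≤ M → 0 < ε₂ → ε₂ ≤ M →
      1 ≤ G.numEdges → G.r ≤ G.numEdges →
      ∃ (s : ℕ → ℕ → ℝ) (steps : ℕ),
        (ApproxDP.run shift ε₁ ε₂ k (Fintype.card V) G.r E.edges).Runs s steps ∧
        (steps : ℝ) ≤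
          C * ((k : ℝ) ^ 2 / (ε₁ * ε₂ ^ 2) * (G.numEdges : ℝ) * Real.log (Fintype.card V) ^ 2) := by
  set N := max M 1 with hN
  have hN1 : 1 ≤ N := le_max_right _ _
  have hMN : M ≤ N := le_max_left _ _
  -- 2100 comes from `wp_run`, 8N from K + 1 ≤ 8Nk/ε₁, and 12N from L ≤ 12N log n / ε₂, which enters
  -- squared.
  refine ⟨2100 * (8 * N) * (12 * N) ^ 2, ?_⟩
  intro V _ _ G E k shift ε₁ ε₂ hk _ hε₁ hε₁M hε₂ hε₂M hm hr
  have hK : 2 * (k * (1 + ε₁)) / ε₁ + 2 ≤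
      ((⌊2 * (k * (1 + ε₁)) / ε₁⌋₊ + 3 : ℕ) : ℝ) := by
    have := Nat.lt_floor_add_one (2 * (k * (1 + ε₁)) / ε₁)
    push_cast
    linarith
  obtain ⟨s, steps, hrun, L, hL, hLn, hc⟩ := ApproxDP.wp_run E hm hr shift hε₁ hε₂ hk hK
  refine ⟨s, steps, hrun, ?_⟩
  have hlog := ApproxDP.log_bound (G.two_le_card hm) hε₂ (hε₂M.trans hMN) hN1 hLn
  set Λ := Real.log (Fintype.card V)
  have hk' : (1 : ℝ) ≤ k := by exact_mod_cast hk
  have hKle : ((⌊2 * (k * (1 + ε₁)) / ε₁⌋₊ + 3 : ℕ) : ℝ) + 1 ≤ 8 * N * k / ε₁ := by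
    have h1 := Nat.floor_le (show 0 ≤ 2 * (k * (1 + ε₁)) / ε₁ by positivity)
    have h2 : 2 * (k * (1 + ε₁)) / ε₁ + 4 ≤ 8 * N * k / ε₁ := by
      rw [div_add' _ _ _ hε₁.ne', div_le_div_iff_of_pos_right hε₁]
      have h3 : ε₁ ≤ N := hε₁M.trans hMN
      have h4 : ε₁ ≤ N * k := h3.trans (by nlinarith)
      have h5 : (k : ℝ) * ε₁ ≤ N * k := by nlinarith
      have h6 : (k : ℝ) ≤ N * k := by nlinarith
      linarith
    push_cast
    linarith
  have hc' : (steps : ℝ) ≤ 2100 * (k * (((⌊2 * (k * (1 + ε₁)) / ε₁⌋₊ + 3 : ℕ) : ℝ) + 1) *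
      (G.numEdges * (L : ℝ) ^ 2)) := by exact_mod_cast hc
  refine hc'.trans ?_
  calc 2100 * (k * (((⌊2 * (k * (1 + ε₁)) / ε₁⌋₊ + 3 : ℕ) : ℝ) + 1) *
      (G.numEdges * (L : ℝ) ^ 2))
      ≤ 2100 * (k * (8 * N * k / ε₁) * (G.numEdges * (12 * N * Λ / ε₂) ^ 2)) := by gcongr
    _ = _ := by field_simp
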